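/- **Setting.** Let $\mathcal A=\bigoplus_{p,q}\mathcal A^{p,q}$ be an Adams-graded commutative dga over $\mathbb Q$ (differential of bidegree $(1,0)$, graded commutative with respect to $p$ only, $\mathcal A^{p,q}=0$ if $q<0$ or $p>2q$); the case of interest is the motivic dga of a field. Let $F$ be a field, let $f\mapsto[f]$ be a function from $F^\times$ to the cocycles in $\mathcal A^{1,1}$, and let $a,b$ be $F$-points of $X=\mathbb P^1-\{0,1,\infty\}$. Write $\Phi_f$ for either $[f]$ or $[1-f]$. *Cellular model.* Fix $N\ge 0$ and put $x_0=a$, $x_{N+1}=b$. Equations $x_i=x_{i+1}$ cut out strata of $X^N$: such a stratum divides $x_1,\dots,x_N$ into consecutive blocks of equal coordinates, a first (possibly empty) block equal to $a$, a last (possibly empty) block equal to $b$, and $n$ nonempty middle blocks with free parameters $U_1,\dots,U_n$. Let $C_n$ be the free left $\mathcal A$-module on the products $c=\Psi_1\cdots\Psi_n$, $\Psi_i\in\{1,[U_i],[1-U_i]\}$, for all strata with $n$ parameters. If $\delta$ of the factors are different from $1$, then $c$ is a cocycle of bidegree $(\delta,\delta)$. The map $\alpha_n:C_n\to C_{n-1}$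 is the alternating sum (signs $+,-,+,\dots$) of the restrictions to $U_1=a$, to $U_i=U_{i+1}$ ($1\le i<n$) and to $U_n=b$. Restriction to $U_i=U_{i+1}$ multiplies the two factors, a product of two factors different from $1$ being replaced by $0$; in the restriction to $U_n=b$ the factor at $b$ is moved to the left of the others, with the sign of graded commutativity. For $\mathcal A$-linear maps $h_n^k:C_n\to C_{n-k}[1-k]$ $(k\ge 1)$ with $h_n^1=\alpha_n$, let $C$ be the matrix whose entry $C_n\to C_{n-k}$ is $d$ for $k=0$ and $\overline{h_n^k}$ for $k\ge1$, where $\overline h(x)=(-1)^{|x|}h(x)$. One says that $h_n^k$ is a homotopy if the entry $C_n\to C_{n-k}$ of $C^2$ vanishes, that is, $$\sum_{j=0}^{k}C_{n-j\to n-k}\,C_{n\to n-j}=0 .$$ *Massey products.* For $x\in\{a,b\}$, a system of Totaro cochains up to length $L$ assigns to every sequence $(\Phi^1,\dots,\Phi^m)$, $1\le m\le L$, a cochain $T_{\Phi^1_x,\dots,\Phi^m_x}\in\mathcal A^{1,m}$, with $T_{\Phi_x}=\Phi_x$ and, for $m\ge2$, $dT_{\Phi^1_x,\dots,\Phi^m_x}=\langle\Phi^1_x,\dots,\Phi^m_x\rangle$,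 where $$\langle\Phi^1_x,\dots,\Phi^m_x\rangle=\sum_{i=1}^{m-1}\overline{T_{\Phi^1_x,\dots,\Phi^i_x}}\;T_{\Phi^{i+1}_x,\dots,\Phi^m_x},\qquad \overline r=(-1)^{p-1}r\ \text{ for } r\in\mathcal A^{p,*},$$ is the representing cochain of the Massey product. This cochain is defined as soon as the system is given up to length $m-1$. **Proposition.** Let $2\le k\le n$ and $\lambda=n(k-1)+\frac{k(k-1)}2$. Below, the first term always lies on the stratum obtained by setting $U_1=\dots=U_k=a$, the second on the one obtained by setting $U_{n-k+1}=\dots=U_n=b$. (1) Let systems of Totaro cochains at $a$ and at $b$ up to length $k-1$ be given. Let $h_i^j$ be $\mathcal A$-linear maps as above with $h_i^1=\alpha_i$ such that, for $2\le j<k$ and $j\le i\le n$, $h_i^j$ is given on the generators $\Phi^1_{U_1}\cdots\Phi^i_{U_i}$ by the formula in (2), with $(j,i)$ in place of $(k,n)$. If $h_n^k:C_n\to C_{n-k}[1-k]$ is a homotopy, then for all generators $\Phi^1_{U_1}\cdots\Phi^n_{U_n}$ of $C_n$ $$d_{n-k}\bigl(h_n^k(\Phi^1_{U_1}\cdots\Phi^n_{U_n})\bigr)=(-1)^\lambda\Bigl(\langle\Phi^1_a,\dots,\Phi^k_a\rangle\,\Phi^{k+1}_{U_{k+1}}\cdots\Phi^n_{U_n}-\langle\Phi^{n-k+1}_b,\dots,\Phi^n_b\rangle\,\Phi^1_{U_1}\cdots\Phi^{n-k}_{U_{n-k}}\Bigr).$$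 (2) Let systems of Totaro cochains at $a$ and at $b$ up to length $k$ be given. Then $h_n^k$ can be defined by $$h_n^k(\Phi^1_{U_1}\cdots\Phi^n_{U_n})=(-1)^\lambda\Bigl(T_{\Phi^1_a,\dots,\Phi^k_a}\,\Phi^{k+1}_{U_{k+1}}\cdots\Phi^n_{U_n}-T_{\Phi^{n-k+1}_b,\dots,\Phi^n_b}\,\Phi^1_{U_1}\cdots\Phi^{n-k}_{U_{n-k}}\Bigr).$$ More precisely, let $h_i^1=\alpha_i$ and, for $j\ge2$, let $h_i^j=0$ if $i<j$ and otherwise, on a generator $\Psi_1\cdots\Psi_i$ of $C_i$ with exactly $\delta$ factors different from $1$, $$h_i^j(\Psi_1\cdots\Psi_i)=(-1)^{\delta(j-1)+\frac{j(j-1)}2}\Bigl(T_{\Psi_1,\dots,\Psi_j}\,\Psi_{j+1}\cdots\Psi_i-(-1)^{(i-\delta)j}\,T_{\Psi_{i-j+1},\dots,\Psi_i}\,\Psi_1\cdots\Psi_{i-j}\Bigr),$$ where the first $T$ is taken at $a$, the second at $b$, and a $T$ with an entry $1$ is $0$. Then $h_n^k$ maps $C_n$ to $C_{n-k}$ with the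 degree shift $[1-k]$, is a homotopy on all of $C_n$, and is given by the previous formula on the generators $\Phi^1_{U_1}\cdots\Phi^n_{U_n}$. -/

import Mathlib

open scoped BigOperators

universe u v

/-- An Adams-graded commutative differential graded `ℚ`-algebra: a bigraded algebra
`R = ⨁ R^{p,q}` (`p` the cohomological degree, `q` the Adams degree) with a differential of
bidegree `(1,0)`, graded commutative for the cohomological degree only, and with `R^{p,q} = 0`
for `q < 0` or `p > 2q`. -/
structure AdamsCDGA (R : Type u) [Ring R] [Algebra ℚ R] where
  gr : ℤ × ℤ → Submodule ℚ R
  graded : GradedAlgebra gr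
  d : R →ₗ[ℚ] R
  d_mem : ∀ (p q : ℤ) (x : R), x ∈ gr (p, q) → d x ∈ gr (p + 1, q)
  d_d : ∀ x : R, d (d x) = 0
  leibniz : ∀ (p q : ℤ) (x y : R), x ∈ gr (p, q) →
    d (x * y) = d x * y + (-1 : ℚ) ^ p • (x * d y)
  comm : ∀ (p q p' q' : ℤ) (x y : R), x ∈ gr (p, q) → y ∈ gr (p', q') →
    x * y = (-1 : ℚ) ^ (p * p') • (y * x)
  vanish : ∀ p q : ℤ, (q < 0 ∨ 2 * q < p) → gr (p, q) = ⊥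

attribute [instance] AdamsCDGA.graded

/-- The two functions `t` and `1 - t` on `ℙ¹ - {0, 1, ∞}`. -/
inductive Letter where
  | t : Letter
  | oneSub : Letter
  deriving DecidableEq

/-- The `F`-rational points of `ℙ¹ - {0, 1, ∞}`. -/
structure PuncturedLine (F : Type v) [Field F] where
  val : F
  ne_zero : val ≠ 0
  ne_one : val ≠ 1

/-- The value at a point of the unit `t` or `1 - t`. -/
def PuncturedLine.eval {F : Type v} [Field F] (a : PuncturedLine F) : Letter → Fˣ
  | .t => Units.mk0 a.val a.ne_zero
  | .oneSub => Units.mk0 (1 - a.val) (sub_ne_zero.mpr a.ne_one.symm)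

/-! ### Cells

Write `X = ℙ¹ - {0, 1, ∞}`, `x₀ = a`, `x_{N+1} = b`. A stratum of `X^N` is cut out by equations
`x_i = x_{i+1}`; it divides `x₁, …, x_N` into consecutive blocks of equal coordinates, of which the
first (possibly empty) is equal to `a`, the last (possibly empty) is equal to `b`, and the `m` middle
ones are nonempty. The stratum is `X^m`, with one parameter `U_i` for every middle block. A cell on it
is a product of `m` factors, the `i`-th one being `1` (label `none`), `[U_i]` (label `some .t`) or
`[1 - U_i]` (label `some .oneSub`). -/

/-- A cell on a stratum of `X^N`: the number of coordinates equal to `a`, the sizes and labels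
of the middle blocks, and the number of coordinates equal to `b`. -/
structure Cell (N : ℕ) where
  atA : ℕ
  blocks : List (ℕ × Option Letter)
  atB : ℕ
  pos : ∀ x ∈ blocks, 0 < x.1
  total : atA + (blocks.map Prod.fst).sum + atB = N

/-- Set the parameters of the blocks numbered `i` and `i + 1` (counting from `0`) equal. -/
def mergeAt : ℕ → List (ℕ × Option Letter) → List (ℕ × Option Letter)
  | 0, (s, u) :: (s', v) :: r => (s + s', u <|> v) :: r
  | i + 1, x :: r => x :: mergeAt i r
  | _, l => l

/-- The coefficient of the restriction to that diagonal: `0` if both factors are different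
from `1`, and `1` otherwise. -/
def mergeCoeff : ℕ → List (ℕ × Option Letter) → ℤ
  | 0, (_, some _) :: (_, some _) :: _ => 0
  | i + 1, _ :: r => mergeCoeff i r
  | _, _ => 1

theorem mergeAt_sum (i : ℕ) (l : List (ℕ × Option Letter)) :
    ((mergeAt i l).map Prod.fst).sum = (l.map Prod.fst).sum := by
  fun_induction mergeAt i l <;> simp_all [add_assoc]

theorem mergeAt_pos (i : ℕ) (l : List (ℕ × Option Letter)) (h : ∀ x ∈ l, 0 < x.1) :
    ∀ x ∈ mergeAt i l, 0 < x.1 := by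
  fun_induction mergeAt i l with
  | case1 s u s' v r =>
    intro x hx
    rcases List.mem_cons.mp hx with rfl | hx
    · have := h (s, u) (by simp)
      simp only at this ⊢
      omega
    · exact h x (by simp [hx])
  | case2 i x r ih =>
    intro y hy
    rcases List.mem_cons.mp hy with rfl | hy
    · exact h y (by simp)
    · exact ih (fun z hz => h z (by simp [hz])) y hy
  | case3 => exact h

namespace Cell

variable {N : ℕ}

/-- The dimension of the stratum. -/
def dim (c : Cell N) : ℕ := c.blocks.length

def labels (c : Cell N) : List (Option Letter) := c.blocks.map Prod.snd

/-- The number of factors different from `1`: the generator has bidegree `(deg, deg)`. -/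
def deg (c : Cell N) : ℕ := c.labels.reduceOption.length

/-- Put the first `k` parameters equal to `a` and delete the corresponding factors. -/
def toA (c : Cell N) (k : ℕ) : Cell N where
  atA := c.atA + ((c.blocks.take k).map Prod.fst).sum
  blocks := c.blocks.drop k
  atB := c.atB
  pos x hx := c.pos x (List.mem_of_mem_drop hx)
  total := by
    have h := c.total
    rw [← List.take_append_drop k c.blocks, List.map_append, List.sum_append] at h
    omega

/-- Put the last `k` parameters equal to `b` and delete the corresponding factors. -/
def toB (c : Cell N) (k : ℕ) : Cell N where
  atA := c.atA
  blocks := c.blocks.take (c.dim - k)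
  atB := ((c.blocks.drop (c.dim - k)).map Prod.fst).sum + c.atB
  pos x hx := c.pos x (List.mem_of_mem_take hx)
  total := by
    have h := c.total
    rw [← List.take_append_drop (c.dim - k) c.blocks, List.map_append, List.sum_append] at h
    omega

/-- Restrict to the diagonal where the parameters numbered `i` and `i + 1` (from `0`) agree. -/
def merge (c : Cell N) (i : ℕ) : Cell N where
  atA := c.atA
  blocks := mergeAt i c.blocks
  atB := c.atB
  pos := mergeAt_pos i c.blocks c.pos
  total := by rw [mergeAt_sum]; exact c.total

end Cell

noncomputable section

namespace AdamsCDGA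

variable {R : Type u} [Ring R] [Algebra ℚ R] (A : AdamsCDGA R) {N : ℕ}

/-- The linear map with `x ↦ (-1)^p x` for `x` of cohomological degree `p`. -/
def sgn : R →ₗ[ℚ] R :=
  (DirectSum.toModule ℚ (ℤ × ℤ) R fun i => (-1 : ℚ) ^ i.1 • (A.gr i).subtype) ∘ₗ
    (DirectSum.decomposeLinearEquiv A.gr).toLinearMap

/-- `⟨w₁, …, w_m⟩ = ∑_{0<i<m} T̄(w₁, …, w_i) T(w_{i+1}, …, w_m)`, where `x̄ = (-1)^{p-1} x` for `x`
of degree `p`: the cochain representing the Massey product of the word `w` that belongs to the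
defining system `T`. -/
def massey (T : List Letter → R) (w : List Letter) : R :=
  ∑ i ∈ Finset.Ico 1 w.length, (-A.sgn (T (w.take i))) * T (w.drop i)

/-- `T` is a system of Totaro cochains, up to length `L`, for the classes `x`: the values on
words of length one are the given ones, and `T w` bounds the Massey product of `w`. -/
structure IsTotaroSystem (x : Letter → R) (L : ℕ) (T : List Letter → R) : Prop where
  letter : ∀ l, T [l] = x l
  mem : ∀ w : List Letter, 2 ≤ w.length → w.length ≤ L → T w ∈ A.gr (1, (w.length : ℤ))
  bound : ∀ w : List Letter, 2 ≤ w.length → w.length ≤ L → A.d (T w) = A.massey T w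

/-- The sum `⨁_m C_m` of the free modules of the cellular model of `X^N`. -/
abbrev CellModule (R : Type u) [Ring R] (N : ℕ) : Type u := Cell N →₀ R

/-- The submodule `C_n`, free on the cells of dimension `n`. -/
abbrev stage (R : Type u) [Ring R] (N n : ℕ) : Submodule R (CellModule R N) :=
  Finsupp.supported R R {c : Cell N | c.dim = n}

/-- A cell, as a generator. -/
abbrev gen (R : Type u) [Ring R] (c : Cell N) : CellModule R N := Finsupp.single c 1

/-- Bidegree `(p, q)` in `⨁_m C_m`, where a cell has bidegree `(deg, deg)`. -/
def HasBidegree (x : CellModule R N) (p q : ℤ) : Prop :=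
  ∀ c : Cell N, x c ∈ A.gr (p - c.deg, q - c.deg)

/-- The internal differential of `⨁_m C_m`; the generators are cocycles. -/
def diff : CellModule R N →ₗ[ℚ] CellModule R N := Finsupp.mapRange.linearMap A.d

/-- The linear map with `x ↦ (-1)^p x` for `x` of cohomological degree `p`. -/
def sgnC : CellModule R N →ₗ[ℚ] CellModule R N :=
  Finsupp.lsum ℚ fun c : Cell N => (-1 : ℚ) ^ c.deg • (Finsupp.lsingle c ∘ₗ A.sgn)

/-- The value at a point of a factor `1`, `[U]` or `[1 - U]`, where `x` gives the classes
of `t` and `1 - t` at the point. -/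
def factorAt (x : Letter → R) : Option Letter → R
  | none => 1
  | some l => x l

/-- The maps `α_m : C_m → C_{m-1}`: the alternating sum of the restrictions to `{a} × X^{m-1}`,
to the diagonals, and to `X^{m-1} × {b}`. In the last one the factor at `b` is moved to the left
of the others. -/
def alpha (xa xb : Letter → R) : CellModule R N →ₗ[R] CellModule R N :=
  Finsupp.linearCombination R fun c =>
    match c.labels.head?, c.labels.getLast? with
    | some u, some v =>
      factorAt xa u • gen R (c.toA 1)
        + ∑ i ∈ Finset.range (c.dim - 1),
            ((-1 : ℤ) ^ (i + 1) * mergeCoeff i c.blocks) • gen R (c.merge i)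
        + ((-1 : ℤ) ^ (c.dim + [v].reduceOption.length * c.labels.dropLast.reduceOption.length)) •
            factorAt xb v • gen R (c.toB 1)
    | _, _ => 0

/-- The sign exponent `λ = n(k-1) + k(k-1)/2`. -/
def signExp (n k : ℕ) : ℕ := n * (k - 1) + k * (k - 1) / 2

/-- `T` on words of labels; it vanishes as soon as one of the labels is `1`. -/
def onLabels (T : List Letter → R) (l : List (Option Letter)) : R :=
  if none ∈ l then 0 else T l.reduceOption

/-- The map `h^k` on `⨁_m C_m` that is given by Totaro cochains, `k ≥ 2`. -/
def totaroMap (Ta Tb : List Letter → R) (k : ℕ) : CellModule R N →ₗ[R] CellModule R N :=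
  Finsupp.linearCombination R fun c =>
    if k ≤ c.dim then
      ((-1 : ℤ) ^ signExp c.deg k) •
        (onLabels Ta (c.labels.take k) • gen R (c.toA k)
          - ((-1 : ℤ) ^ ((c.dim - c.deg) * k)) •
              onLabels Tb (c.labels.drop (c.dim - k)) • gen R (c.toB k))
    else 0

/-- The family with `h^1 = α` and with the other `h^k` given by Totaro cochains. -/
def totaroFamily (xa xb : Letter → R) (Ta Tb : List Letter → R) (k : ℕ) :
    CellModule R N →ₗ[R] CellModule R N :=
  if k = 1 then alpha xa xb else totaroMap Ta Tb k

/-- The entries `C_n → C_{n-k}` of the matrix of the differential of the cell module: `d` for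
`k = 0`, and `h̄^k` with `h̄(x) = (-1)^{|x|} h(x)` for `k ≥ 1`. -/
def entry (h : ℕ → CellModule R N →ₗ[R] CellModule R N) :
    ℕ → CellModule R N →ₗ[ℚ] CellModule R N
  | 0 => A.diff
  | k + 1 => (h (k + 1)).restrictScalars ℚ ∘ₗ A.sgnC

/-- The entries `C_n → C_{n-k}` of the square of that matrix. -/
def squareEntry (h : ℕ → CellModule R N →ₗ[R] CellModule R N) (k : ℕ) :
    CellModule R N →ₗ[ℚ] CellModule R N :=
  ∑ j ∈ Finset.range (k + 1), A.entry h (k - j) ∘ₗ A.entry h j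

/-- `h^k` is a homotopy `C_n → C_{n-k}[1-k]` as required for the cell module: it has the right
degree, and the entry `C_n → C_{n-k}` of the square of the matrix vanishes. -/
structure IsHomotopy (h : ℕ → CellModule R N →ₗ[R] CellModule R N) (n k : ℕ) : Prop where
  maps : ∀ x ∈ stage R N n, h k x ∈ stage R N (n - k)
  degree : ∀ x ∈ stage R N n, ∀ p q : ℤ, A.HasBidegree x p q →
    A.HasBidegree (h k x) (p + 1 - k) q
  square : ∀ x ∈ stage R N n, A.squareEntry h k x = 0

/-- `(-1)^λ (r · Φ^{k+1}_{U_{k+1}}⋯Φ^n_{U_n} - s · Φ^1_{U_1}⋯Φ^{n-k}_{U_{n-k}})` for the cell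
`c = Φ^1_{U_1}⋯Φ^n_{U_n}`, on the strata where the first `k` parameters are `a`, respectively the
last `k` are `b`. -/
def signedDiff (k : ℕ) (r s : R) (c : Cell N) : CellModule R N :=
  ((-1 : ℤ) ^ signExp c.dim k) • (r • gen R (c.toA k) - s • gen R (c.toB k))

end AdamsCDGA

end

/-!
The entry `C_n → C_{n-k}` of the square of the matrix, on a homogeneous multiple of a cell `c`, is a
multiple of `d (h^k c) + ∑_{0<j<k} ± h^{k-j} (h^j c)` (`squareEntry_single`), so both claims are about
this expression on cells.

The map `α` is a sum of two parts (`alpha_gen`). One evaluates a letter at `a` or at `b`; it is given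
by the formula for `h^k` with `k = 1`, that is, by `totaroMap` with `T` the letter itself. The other,
`degen`, evaluates factors `1` at the two ends and sets neighbouring parameters equal; it vanishes
on cells without factors `1`.

Two of the maps `totaroMap` compose to products of two Totaro cochains, one for each choice of the
ends (`totaroMap_sgnC_totaroMap`). The sign exponents add up to `λ + 1` (`signExp_comp`), the products
with one factor at `a` and one at `b` cancel in pairs by graded commutativity, and the others add up
to the Massey cochains (`sum_totaroMap_sgnC_totaroMap`). These are the coboundaries of the Totaro
cochains, which makes the sum with `d (h^k c)` vanish; conversely, the homotopy equation determines
`d (h^k c)` on a cell without factors `1`.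

The remaining terms, in the presence of factors `1`, are those with `degen`. They cancel because
`degen` has square zero (`degen_degenCell`) and commutes up to the sign `(-1)^m` with the `m`-th map
`totaroMap` (`totaroMap_degenCell`). To see both, add the end blocks at `a` and `b` to the list of
blocks of a cell, labelled by a letter: then `degen` is the bar differential of lists of blocks, for
the partial multiplication of labels in which a product of two letters is zero
(`padMap_degenCell`). The bar differential has square zero, it anticommutes with the absorption of a
first letter into the end block at `a`, and it commutes with the absorption of a last letter into the
end block at `b`; the maps `totaroMap` are combinations of iterated absorptions.
-/

namespace AdamsCDGA

/-! ### The bar differential on lists of blocks -/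

section Bar

variable {R : Type u} [Ring R]

/-- The block obtained by setting the parameters of two neighbouring blocks equal. -/
def joinBlock (x y : ℕ × Option Letter) : ℕ × Option Letter := (x.1 + y.1, x.2 <|> y.2)

/-- The coefficient of `joinBlock` in the restriction to a diagonal: a product of two factors
different from `1` is replaced by `0`. -/
def joinCoeff : Option Letter → Option Letter → ℤ
  | some _, some _ => 0
  | _, _ => 1

/-- The free module on the lists of blocks. -/
abbrev BlockModule (R : Type u) [Ring R] : Type u := List (ℕ × Option Letter) →₀ R

/-- Put a block in front. -/
noncomputable def consMap (x : ℕ × Option Letter) : BlockModule R →ₗ[R] BlockModule R :=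
  Finsupp.lmapDomain R R (List.cons x)

@[simp]
theorem consMap_single (x : ℕ × Option Letter) (l : List (ℕ × Option Letter)) (r : R) :
    consMap x (Finsupp.single l r) = Finsupp.single (x :: l) r := by
  simp [consMap]

/-- The bar differential of a list of blocks: the alternating sum over all ways to join two
neighbours. -/
noncomputable def bar : List (ℕ × Option Letter) → BlockModule R
  | [] => 0
  | [_] => 0
  | x :: y :: r =>
    joinCoeff x.2 y.2 • Finsupp.single (joinBlock x y :: r) 1 - consMap x (bar (y :: r))

/-- The linear extension of `bar`. -/
noncomputable def barMap : BlockModule R →ₗ[R] BlockModule R := Finsupp.linearCombination R bar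

@[simp]
theorem barMap_single (l : List (ℕ × Option Letter)) :
    barMap (Finsupp.single l (1 : R)) = bar l := by
  simp [barMap]

/-- Join a given block to the first block of a list. -/
noncomputable def joinMap (x : ℕ × Option Letter) : BlockModule R →ₗ[R] BlockModule R :=
  Finsupp.linearCombination R fun
    | [] => 0
    | y :: r => joinCoeff x.2 y.2 • Finsupp.single (joinBlock x y :: r) 1

@[simp]
theorem joinMap_single_nil (x : ℕ × Option Letter) :
    joinMap x (Finsupp.single [] (1 : R)) = 0 := by
  simp [joinMap]

@[simp]
theorem joinMap_single_cons (x y : ℕ × Option Letter) (r : List (ℕ × Option Letter)) :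
    joinMap x (Finsupp.single (y :: r) (1 : R)) =
      joinCoeff x.2 y.2 • Finsupp.single (joinBlock x y :: r) 1 := by
  simp [joinMap]

theorem eq_of_eq_on_single {ι M : Type*} [AddCommGroup M] [Module R M] {f g : (ι →₀ R) →ₗ[R] M}
    (h : ∀ i, f (Finsupp.single i 1) = g (Finsupp.single i 1)) : f = g :=
  Finsupp.lhom_ext' fun i => LinearMap.ext_ring (by simpa using h i)

theorem barMap_consMap (x : ℕ × Option Letter) (z : BlockModule R) :
    barMap (consMap x z) = joinMap x z - consMap x (barMap z) := by
  suffices h : barMap ∘ₗ consMap x = joinMap x - consMap x ∘ₗ barMap (R := R) from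
    LinearMap.congr_fun h z
  refine eq_of_eq_on_single fun l => ?_
  cases l <;> simp [bar]

theorem joinMap_consMap (x y : ℕ × Option Letter) (z : BlockModule R) :
    joinMap x (consMap y z) = joinCoeff x.2 y.2 • consMap (joinBlock x y) z := by
  suffices h : joinMap x ∘ₗ consMap y = joinCoeff x.2 y.2 • consMap (R := R) (joinBlock x y) from
    LinearMap.congr_fun h z
  exact eq_of_eq_on_single fun l => by simp

/-- Joining blocks is associative. -/
theorem joinMap_joinMap (x y : ℕ × Option Letter) (z : BlockModule R) :
    joinMap x (joinMap y z) = joinCoeff x.2 y.2 • joinMap (joinBlock x y) z := by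
  suffices h : joinMap x ∘ₗ joinMap y = joinCoeff x.2 y.2 • joinMap (R := R) (joinBlock x y) from
    LinearMap.congr_fun h z
  refine eq_of_eq_on_single fun l => ?_
  obtain _ | ⟨z, r⟩ := l
  · simp
  · obtain ⟨x, _ | _⟩ := x <;> obtain ⟨y, _ | _⟩ := y <;> obtain ⟨z, _ | _⟩ := z <;>
      simp [joinCoeff, joinBlock, add_assoc]

theorem bar_cons (x : ℕ × Option Letter) (l : List (ℕ × Option Letter)) :
    bar (R := R) (x :: l) = joinMap x (Finsupp.single l 1) - consMap x (bar l) := by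
  cases l <;> simp [bar]

theorem barMap_joinMap (x : ℕ × Option Letter) (z : BlockModule R) :
    barMap (joinMap x z) = joinMap x (barMap z) := by
  suffices h : barMap ∘ₗ joinMap x = joinMap x ∘ₗ barMap (R := R) from LinearMap.congr_fun h z
  refine eq_of_eq_on_single fun l => ?_
  obtain _ | ⟨y, r⟩ := l
  · simp [bar]
  · simp only [LinearMap.comp_apply, joinMap_single_cons, map_zsmul, barMap_single, bar_cons, map_sub,
      joinMap_joinMap, joinMap_consMap, smul_sub]

theorem barMap_bar (l : List (ℕ × Option Letter)) : barMap (bar l) = (0 : BlockModule R) := by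
  induction l with
  | nil => simp [bar]
  | cons x r ih => simp [bar_cons, barMap_consMap, barMap_joinMap, ih]

theorem bar_eq_sum (l : List (ℕ × Option Letter)) :
    bar (R := R) l = ∑ i ∈ Finset.range (l.length - 1),
      ((-1 : ℤ) ^ i * mergeCoeff i l) • Finsupp.single (mergeAt i l) 1 := by
  induction l with
  | nil => simp [bar]
  | cons x r ih =>
    obtain _ | ⟨y, r⟩ := r
    · simp [bar]
    · have h0 : mergeCoeff 0 (x :: y :: r) = joinCoeff x.2 y.2 := by
        obtain ⟨_, _ | _⟩ := x <;> obtain ⟨_, _ | _⟩ := y <;> rfl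
      rw [bar, ih]
      simp only [List.length_cons, Nat.add_sub_cancel]
      rw [Finset.sum_range_succ', map_sum, h0]
      simp only [mergeAt, mergeCoeff, pow_succ, map_zsmul, consMap_single, pow_zero, one_mul,
        mul_neg, mul_one, neg_mul, neg_smul, Finset.sum_neg_distrib]
      rw [add_comm, sub_eq_add_neg]
      rfl

/-- Absorb the second block of a list into the first one if its factor is the letter `l`;
otherwise the result is zero. -/
noncomputable def absorbFirst (l : Letter) : BlockModule R →ₗ[R] BlockModule R :=
  Finsupp.linearCombination R fun
    | e :: x :: r => if x.2 = some l then Finsupp.single ((e.1 + x.1, e.2) :: r) 1 else 0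
    | _ => 0

theorem absorbFirst_single (l : Letter) (e x : ℕ × Option Letter) (r : List (ℕ × Option Letter)) :
    absorbFirst l (Finsupp.single (e :: x :: r) (1 : R)) =
      if x.2 = some l then Finsupp.single ((e.1 + x.1, e.2) :: r) 1 else 0 := by
  simp [absorbFirst]

theorem absorbFirst_consMap (l : Letter) (e x : ℕ × Option Letter) (z : BlockModule R) :
    absorbFirst l (consMap e (consMap x z)) =
      if x.2 = some l then consMap (e.1 + x.1, e.2) z else 0 := by
  suffices h : absorbFirst l ∘ₗ consMap e ∘ₗ consMap x =
      if x.2 = some l then consMap (R := R) (e.1 + x.1, e.2) else 0 by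
    rw [← LinearMap.comp_apply, ← LinearMap.comp_apply, LinearMap.comp_assoc, h]
    split_ifs <;> rfl
  refine eq_of_eq_on_single fun l => ?_
  split_ifs <;> simp [absorbFirst_single, *]

/-- If the first block of the list is not labelled `1`, then joining a block labelled `1` that
precedes a letter to the left or to the right gives the same after absorption, with opposite
signs; this is why `absorbFirst` anticommutes with the bar differential. -/
theorem absorbFirst_bar (l : Letter) (m : ℕ) (u : Letter) (r : List (ℕ × Option Letter)) :
    absorbFirst l (bar ((m, some u) :: r)) =
      -barMap (absorbFirst l (Finsupp.single ((m, some u) :: r) (1 : R))) := by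
  obtain _ | ⟨⟨s, x⟩, _ | ⟨⟨s', y⟩, r⟩⟩ := r
  · simp [bar, absorbFirst]
  · cases x <;> simp [bar, absorbFirst, joinCoeff, apply_ite]
  · rw [absorbFirst_single]
    obtain _ | x := x <;> obtain _ | y := y
    all_goals
      simp only [bar, joinCoeff, joinBlock, one_smul, zero_smul, map_sub, consMap_single,
        absorbFirst_consMap, absorbFirst_single, zero_sub, map_neg]
      try split_ifs
      all_goals simp_all [bar, joinCoeff, joinBlock, add_assoc]

/-- Absorb the last but one block of a list into the last one if its factor is the letter `l`;
otherwise the result is zero. -/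
noncomputable def absorbLastAux (l : Letter) : List (ℕ × Option Letter) → BlockModule R
  | [] => 0
  | [_] => 0
  | [x, f] => if x.2 = some l then Finsupp.single [(x.1 + f.1, f.2)] 1 else 0
  | x :: y :: z :: r => consMap x (absorbLastAux l (y :: z :: r))

/-- The linear extension of `absorbLastAux`. -/
noncomputable def absorbLast (l : Letter) : BlockModule R →ₗ[R] BlockModule R :=
  Finsupp.linearCombination R (absorbLastAux l)

@[simp]
theorem absorbLast_single (l : Letter) (r : List (ℕ × Option Letter)) :
    absorbLast l (Finsupp.single r (1 : R)) = absorbLastAux l r := by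
  simp [absorbLast]

theorem absorbLastAux_concat (l : Letter) (r : List (ℕ × Option Letter)) (x f : ℕ × Option Letter) :
    absorbLastAux (R := R) l (r ++ [x, f]) =
      if x.2 = some l then Finsupp.single (r ++ [(x.1 + f.1, f.2)]) 1 else 0 := by
  induction r with
  | nil => simp [absorbLastAux]
  | cons y r ih =>
    obtain _ | ⟨z, _ | ⟨w, r⟩⟩ := r <;>
      simp only [List.cons_append, List.nil_append] at ih ⊢ <;>
      rw [absorbLastAux, ih] <;> split_ifs <;> simp

theorem mergeAt_ne_nil (i : ℕ) {l : List (ℕ × Option Letter)} (h : l ≠ []) : mergeAt i l ≠ [] := by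
  fun_cases mergeAt i l <;> simp_all

theorem absorbLast_consMap_consMap_bar (l : Letter) (x y : ℕ × Option Letter)
    (r : List (ℕ × Option Letter)) :
    absorbLast l (consMap x (consMap y (bar (R := R) r))) =
      consMap x (absorbLast l (consMap y (bar r))) := by
  rcases eq_or_ne r [] with rfl | hr
  · simp [bar]
  · rw [bar_eq_sum]
    simp only [map_sum, map_zsmul, consMap_single, absorbLast_single]
    refine Finset.sum_congr rfl fun i _ => ?_
    obtain ⟨z, t, h⟩ := List.exists_cons_of_ne_nil (mergeAt_ne_nil i hr)
    rw [h, absorbLastAux]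

/-- If the last block of the list is not labelled `1`, then `absorbLast` commutes with the bar
differential. -/
theorem absorbLast_bar (l : Letter) (r : List (ℕ × Option Letter)) (m : ℕ) (u : Letter) :
    absorbLast l (bar (R := R) (r ++ [(m, some u)])) =
      barMap (absorbLastAux l (r ++ [(m, some u)])) := by
  induction r with
  | nil => simp [bar, absorbLastAux]
  | cons x r ih =>
    obtain _ | ⟨y, _ | ⟨z, r⟩⟩ := r
    · simp only [List.cons_append, List.nil_append, bar, absorbLastAux]
      split_ifs <;> simp only [map_zsmul, absorbLast_single, absorbLastAux, map_zero,
        barMap_single, bar, smul_zero, sub_zero]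
    · clear ih
      obtain ⟨s, _ | x⟩ := x <;> obtain ⟨t, _ | y⟩ := y
      all_goals
        simp only [List.cons_append, List.nil_append, bar, absorbLastAux, joinCoeff, joinBlock,
          map_sub, one_smul, zero_smul, absorbLast_single, consMap_single, map_zero, sub_zero,
          reduceCtorEq, if_false, Option.orElse_eq_orElse, Option.orElse_none]
        try split_ifs
        all_goals simp_all [bar, joinCoeff, joinBlock, add_assoc]
    · simp only [List.cons_append] at ih ⊢
      have key : absorbLast l (consMap x (bar (R := R) (y :: z :: (r ++ [(m, some u)])))) =
          consMap x (absorbLast l (bar (y :: z :: (r ++ [(m, some u)])))) := by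
        rw [bar]
        obtain ⟨f, t, ht⟩ : ∃ f t, r ++ [(m, some u)] = f :: t :=
          List.exists_cons_of_ne_nil (by simp)
        simp only [map_sub, map_zsmul, absorbLast_consMap_consMap_bar, consMap_single,
          absorbLast_single, ht]
        rw [absorbLastAux]
      obtain ⟨f, t, ht⟩ : ∃ f t, r ++ [(m, some u)] = f :: t :=
        List.exists_cons_of_ne_nil (by simp)
      rw [bar, map_sub, key, ih, absorbLastAux, barMap_consMap, map_zsmul, absorbLast_single, ht,
        absorbLastAux, absorbLastAux, joinMap_consMap]

end Bar
/-! ### Degenerate restrictions of cells -/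

section Degenerate

variable {R : Type u} [Ring R] {N : ℕ}

theorem _root_.Cell.ext' {c c' : Cell N} (hA : c.atA = c'.atA) (h : c.blocks = c'.blocks)
    (hB : c.atB = c'.atB) : c = c' := by
  cases c; cases c'; simp_all

/-- The list of blocks of a cell together with the two end blocks at `a` and `b`. The end blocks
carry a letter, so that joining them to a block has coefficient zero unless that block is labelled
`1`; which letter is irrelevant for the bar differential. -/
def _root_.Cell.pad (v w : Letter) (c : Cell N) : List (ℕ × Option Letter) :=
  (c.atA, some v) :: (c.blocks ++ [(c.atB, some w)])

theorem _root_.Cell.pad_injective (v w : Letter) : Function.Injective (Cell.pad (N := N) v w) := by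
  intro c c' h
  simp only [Cell.pad, List.cons.injEq, Prod.mk.injEq, and_true] at h
  obtain ⟨h1, h2⟩ := h
  have := List.append_inj' h2 rfl
  refine Cell.ext' h1 this.1 ?_
  simpa using this.2

/-- The embedding of the cells into the lists of blocks by `Cell.pad`. -/
noncomputable def padMap (v w : Letter) : CellModule R N →ₗ[R] BlockModule R :=
  Finsupp.lmapDomain R R (Cell.pad v w)

@[simp]
theorem padMap_single (v w : Letter) (c : Cell N) (r : R) :
    padMap v w (Finsupp.single c r) = Finsupp.single (c.pad v w) r := by
  simp [padMap]

theorem padMap_injective (v w : Letter) :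
    Function.Injective (padMap (R := R) (N := N) v w) :=
  Finsupp.mapDomain_injective (Cell.pad_injective v w)

/-- The value on a cell of the part of `α` in which no letter is evaluated at `a` or `b`: factors
`1` are evaluated at the two ends, and neighbouring parameters are set equal. -/
noncomputable def degenCell (c : Cell N) : CellModule R N :=
  (if c.labels.head? = some none then gen R (c.toA 1) else 0)
    + ∑ i ∈ Finset.range (c.dim - 1),
        ((-1 : ℤ) ^ (i + 1) * mergeCoeff i c.blocks) • gen R (c.merge i)
    + (-1 : ℤ) ^ c.dim • (if c.labels.getLast? = some none then gen R (c.toB 1) else 0)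

/-- The part of `α` in which no letter is evaluated at `a` or `b`. -/
noncomputable def degen : CellModule R N →ₗ[R] CellModule R N :=
  Finsupp.linearCombination R degenCell

@[simp]
theorem degen_single (c : Cell N) : degen (Finsupp.single c (1 : R)) = degenCell c := by
  simp [degen]

theorem mergeAt_append (i : ℕ) (l : List (ℕ × Option Letter)) (y : ℕ × Option Letter)
    (h : i + 1 < l.length) : mergeAt i (l ++ [y]) = mergeAt i l ++ [y] := by
  induction l generalizing i with
  | nil => simp at h
  | cons x r ih =>
    cases i with
    | zero =>
      obtain _ | ⟨z, r⟩ := r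
      · simp at h
      · simp [mergeAt]
    | succ i => simp [mergeAt, ih i (by simpa using h)]

theorem mergeCoeff_append (i : ℕ) (l : List (ℕ × Option Letter)) (y : ℕ × Option Letter)
    (h : i + 1 < l.length) : mergeCoeff i (l ++ [y]) = mergeCoeff i l := by
  induction l generalizing i with
  | nil => simp at h
  | cons x r ih =>
    cases i with
    | zero =>
      obtain _ | ⟨z, r⟩ := r
      · simp at h
      · obtain ⟨_, _ | _⟩ := x <;> obtain ⟨_, _ | _⟩ := z <;> simp [mergeCoeff]
    | succ i => simp [mergeCoeff, ih i (by simpa using h)]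

theorem mergeAt_length_append (l : List (ℕ × Option Letter)) (x y : ℕ × Option Letter) :
    mergeAt l.length (l ++ [x, y]) = l ++ [joinBlock x y] := by
  induction l with
  | nil => rfl
  | cons z r ih => simp [mergeAt, ih]

theorem mergeCoeff_length_append (l : List (ℕ × Option Letter)) (x y : ℕ × Option Letter) :
    mergeCoeff l.length (l ++ [x, y]) = joinCoeff x.2 y.2 := by
  induction l with
  | nil => obtain ⟨_, _ | _⟩ := x <;> obtain ⟨_, _ | _⟩ := y <;> rfl
  | cons z r ih => simp [mergeCoeff, ih]

/-- On padded lists of blocks, `degen` is the bar differential. -/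
theorem padMap_degenCell (v w : Letter) (c : Cell N) :
    padMap v w (degenCell (R := R) c) = bar (c.pad v w) := by
  obtain ⟨p, l, q, hpos, htot⟩ := c
  obtain rfl | ⟨r, y, rfl⟩ := List.eq_nil_or_concat' l
  · simp [degenCell, Cell.labels, Cell.dim, Cell.pad, bar, joinCoeff]
  · have hlen : (Cell.pad v w ⟨p, r ++ [y], q, hpos, htot⟩).length - 1 = r.length + 1 + 1 := by
      simp [Cell.pad]
    -- The first and the last summand of the bar differential are the restrictions at the two ends.
    rw [bar_eq_sum, hlen, Finset.sum_range_succ, Finset.sum_range_succ', degenCell]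
    simp only [map_add, map_sum, map_zsmul, padMap_single, apply_ite (padMap v w), map_zero]
    have h1 : (Cell.dim ⟨p, r ++ [y], q, hpos, htot⟩) = r.length + 1 := by simp [Cell.dim]
    rw [h1, Nat.add_sub_cancel]
    congr 1
    · rw [add_comm]
      congr 1
      · refine Finset.sum_congr rfl fun i hi => ?_
        have hi' : i + 1 < (r ++ [y]).length := by simpa using hi
        simp only [Cell.pad, mergeCoeff, mergeAt, Cell.merge, mergeAt_append _ _ _ hi',
          mergeCoeff_append _ _ _ hi']
      · obtain _ | ⟨x, r⟩ := r
        · obtain ⟨s, _ | y⟩ := y <;> simp [Cell.labels, Cell.toA, Cell.pad, mergeCoeff, mergeAt]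
        · obtain ⟨s, _ | x⟩ := x <;> simp [Cell.labels, Cell.toA, Cell.pad, mergeCoeff, mergeAt]
    · have h2 := mergeAt_length_append ((p, some v) :: r) y (q, some w)
      have h3 := mergeCoeff_length_append ((p, some v) :: r) y (q, some w)
      simp only [List.length_cons, List.cons_append] at h2 h3
      simp only [Cell.pad, List.append_assoc, List.cons_append, List.nil_append, h2, h3]
      obtain ⟨s, _ | y⟩ := y <;>
        simp [Cell.labels, Cell.toB, Cell.dim, joinCoeff, joinBlock]

theorem padMap_degen (v w : Letter) (z : CellModule R N) :
    padMap v w (degen z) = barMap (padMap v w z) := by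
  suffices h : padMap v w ∘ₗ degen = barMap ∘ₗ padMap (R := R) (N := N) v w from
    LinearMap.congr_fun h z
  exact eq_of_eq_on_single fun c => by simp [padMap_degenCell]

theorem degen_degenCell (c : Cell N) : degen (degenCell (R := R) c) = 0 := by
  apply padMap_injective .t .t
  rw [padMap_degen, padMap_degenCell, barMap_bar, map_zero]

end Degenerate
/-! ### Evaluation of letters at the two ends -/

section Ends

variable {R : Type u} [Ring R] {N : ℕ}

/-- Put the first parameter equal to `a` if its factor is the letter `l`; otherwise zero. -/
noncomputable def evalFirst (l : Letter) : CellModule R N →ₗ[R] CellModule R N :=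
  Finsupp.linearCombination R fun c =>
    if c.labels.head? = some (some l) then gen R (c.toA 1) else 0

/-- Put the last parameter equal to `b` if its factor is the letter `l`; otherwise zero. -/
noncomputable def evalLast (l : Letter) : CellModule R N →ₗ[R] CellModule R N :=
  Finsupp.linearCombination R fun c =>
    if c.labels.getLast? = some (some l) then gen R (c.toB 1) else 0

/-- The end block at `b` has to carry a letter different from `l`, so that it is never absorbed. -/
theorem padMap_evalFirst {v w l : Letter} (h : w ≠ l) (z : CellModule R N) :
    padMap v w (evalFirst l z) = absorbFirst l (padMap v w z) := by
  suffices h : padMap v w ∘ₗ evalFirst l = absorbFirst l ∘ₗ padMap (R := R) (N := N) v w from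
    LinearMap.congr_fun h z
  refine eq_of_eq_on_single fun c => ?_
  obtain ⟨p, _ | ⟨⟨s, x⟩, r⟩, q, hpos, htot⟩ := c
  · simp [evalFirst, Cell.labels, Cell.pad, absorbFirst_single, h]
  · by_cases hx : x = some l <;>
      simp [evalFirst, Cell.labels, Cell.pad, absorbFirst_single, Cell.toA, hx]

/-- The end block at `a` has to carry a letter different from `l`, so that it is never absorbed. -/
theorem padMap_evalLast {v w l : Letter} (h : v ≠ l) (z : CellModule R N) :
    padMap v w (evalLast l z) = absorbLast l (padMap v w z) := by
  suffices h : padMap v w ∘ₗ evalLast l = absorbLast l ∘ₗ padMap (R := R) (N := N) v w from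
    LinearMap.congr_fun h z
  refine eq_of_eq_on_single fun c => ?_
  obtain ⟨p, r, q, hpos, htot⟩ := c
  obtain rfl | ⟨r, ⟨s, x⟩, rfl⟩ := List.eq_nil_or_concat' r
  · simp [evalLast, Cell.labels, Cell.pad, absorbLastAux, h]
  · have := absorbLastAux_concat (R := R) l ((p, some v) :: r) (s, x) (q, some w)
    simp only [List.cons_append] at this
    by_cases hx : x = some l <;> simp only [hx, if_true, if_false] at this <;>
      simp [evalLast, Cell.labels, Cell.pad, Cell.toB, Cell.dim, this, hx]

theorem exists_letter_ne (l : Letter) : ∃ v, v ≠ l := by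
  cases l
  · exact ⟨.oneSub, by decide⟩
  · exact ⟨.t, by decide⟩

theorem evalFirst_degen (l : Letter) (z : CellModule R N) :
    evalFirst l (degen z) = -degen (evalFirst l z) := by
  suffices h : evalFirst l ∘ₗ degen = -degen (R := R) (N := N) ∘ₗ evalFirst l from
    LinearMap.congr_fun h z
  refine eq_of_eq_on_single fun c => ?_
  obtain ⟨w, hw⟩ := exists_letter_ne l
  apply padMap_injective w w
  simp only [LinearMap.comp_apply, LinearMap.neg_apply, map_neg, padMap_evalFirst hw, padMap_degen,
    padMap_single, barMap_single]
  exact absorbFirst_bar _ _ _ _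

theorem evalLast_degen (l : Letter) (z : CellModule R N) :
    evalLast l (degen z) = degen (evalLast l z) := by
  suffices h : evalLast l ∘ₗ degen = degen (R := R) (N := N) ∘ₗ evalLast l from
    LinearMap.congr_fun h z
  refine eq_of_eq_on_single fun c => ?_
  obtain ⟨w, hw⟩ := exists_letter_ne l
  apply padMap_injective w w
  simp only [LinearMap.comp_apply, padMap_evalLast hw, padMap_degen, padMap_single, barMap_single,
    absorbLast_single]
  exact absorbLast_bar l ((c.atA, some w) :: c.blocks) c.atB w

/-- Put the first `m` parameters equal to `a` and multiply by the value of `T` on their labels. -/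
noncomputable def totaroFirst (T : List Letter → R) (m : ℕ) : CellModule R N →ₗ[R] CellModule R N :=
  Finsupp.linearCombination R fun c =>
    if m ≤ c.dim then onLabels T (c.labels.take m) • gen R (c.toA m) else 0

/-- Put the last `m` parameters equal to `b` and multiply by the value of `T` on their labels. -/
noncomputable def totaroLast (T : List Letter → R) (m : ℕ) : CellModule R N →ₗ[R] CellModule R N :=
  Finsupp.linearCombination R fun c =>
    if m ≤ c.dim then onLabels T (c.labels.drop (c.dim - m)) • gen R (c.toB m) else 0

theorem onLabels_map_some (T : List Letter → R) (w : List Letter) :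
    onLabels T (w.map some) = T w := by
  have : (w.map some).reduceOption = w := by
    induction w with
    | nil => rfl
    | cons x r ih => simp [ih]
  simp [onLabels, this]

theorem onLabels_none_cons (T : List Letter → R) (u : List (Option Letter)) :
    onLabels T (none :: u) = 0 := by
  simp [onLabels]

theorem onLabels_some_cons (T : List Letter → R) (l : Letter) (u : List (Option Letter)) :
    onLabels T (some l :: u) = onLabels (fun w => T (l :: w)) u := by
  simp [onLabels]

theorem onLabels_concat_none (T : List Letter → R) (u : List (Option Letter)) :
    onLabels T (u ++ [none]) = 0 := by
  simp [onLabels]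

theorem onLabels_concat_some (T : List Letter → R) (l : Letter) (u : List (Option Letter)) :
    onLabels T (u ++ [some l]) = onLabels (fun w => T (w ++ [l])) u := by
  simp [onLabels, List.reduceOption_append]

/-- Evaluate the first letter, then the remaining `m`: this reduces `totaroFirst` to `evalFirst`. -/
theorem totaroFirst_succ (T : List Letter → R) (m : ℕ) (z : CellModule R N) :
    totaroFirst T (m + 1) z =
      totaroFirst (fun w => T (.t :: w)) m (evalFirst .t z) +
        totaroFirst (fun w => T (.oneSub :: w)) m (evalFirst .oneSub z) := by
  suffices h : totaroFirst T (m + 1) =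
      totaroFirst (fun w => T (.t :: w)) m ∘ₗ evalFirst (R := R) (N := N) .t +
        totaroFirst (fun w => T (.oneSub :: w)) m ∘ₗ evalFirst .oneSub from LinearMap.congr_fun h z
  refine eq_of_eq_on_single fun c => ?_
  obtain ⟨p, _ | ⟨⟨s, _ | _ | _⟩, r⟩, q, hpos, htot⟩ := c
  · simp [totaroFirst, evalFirst, Cell.labels, Cell.dim]
  all_goals
    simp [totaroFirst, evalFirst, Cell.labels, Cell.dim, onLabels_none_cons, onLabels_some_cons,
      Cell.toA, add_assoc]

/-- Evaluate the last letter, then the remaining `m`: this reduces `totaroLast` to `evalLast`. -/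
theorem totaroLast_succ (T : List Letter → R) (m : ℕ) (z : CellModule R N) :
    totaroLast T (m + 1) z =
      totaroLast (fun w => T (w ++ [.t])) m (evalLast .t z) +
        totaroLast (fun w => T (w ++ [.oneSub])) m (evalLast .oneSub z) := by
  suffices h : totaroLast T (m + 1) =
      totaroLast (fun w => T (w ++ [.t])) m ∘ₗ evalLast (R := R) (N := N) .t +
        totaroLast (fun w => T (w ++ [.oneSub])) m ∘ₗ evalLast .oneSub from LinearMap.congr_fun h z
  refine eq_of_eq_on_single fun c => ?_
  obtain ⟨p, r, q, hpos, htot⟩ := c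
  obtain rfl | ⟨r, ⟨s, x⟩, rfl⟩ := List.eq_nil_or_concat' r
  · simp [totaroLast, evalLast, Cell.labels, Cell.dim]
  · have h1 : ∀ {β : Type} (f : ℕ × Option Letter → β),
        ((r ++ [(s, x)]).map f).drop (r.length - m) =
          (r.map f).drop (r.length - m) ++ [f (s, x)] := by
      intro β f
      rw [List.map_append, List.drop_append_of_le_length (by simp)]
      rfl
    have h2 : List.drop (r.length - m) (r ++ [(s, x)]) = r.drop (r.length - m) ++ [(s, x)] :=
      List.drop_append_of_le_length (by simp)
    have h3 : List.take (r.length - m) (r ++ [(s, x)]) = r.take (r.length - m) :=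
      List.take_append_of_le_length (by simp)
    obtain _ | _ | _ := x
    all_goals
      simp only [totaroLast, evalLast, Cell.labels, Cell.dim, onLabels_concat_none, h1,
        onLabels_concat_some, Finsupp.linearCombination_single, LinearMap.comp_apply,
        LinearMap.add_apply, List.length_append, List.length_singleton, Nat.add_sub_add_right,
        Nat.add_le_add_iff_right, one_smul, zero_smul, ite_self]
      simp [Cell.toB, Cell.dim, h2, h3, add_assoc]

/-- Right multiplication by an element of `R` commutes with `degen`, whose coefficients are
integers. -/
theorem map_degen_of_scalar {f : CellModule R N →ₗ[R] CellModule R N} {t : R}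
    (hf : ∀ c : Cell N, f (gen R c) = t • gen R c) (z : CellModule R N) :
    f (degen z) = degen (f z) := by
  suffices h : f ∘ₗ degen = degen ∘ₗ f from LinearMap.congr_fun h z
  refine eq_of_eq_on_single fun c => ?_
  simp only [LinearMap.comp_apply, hf, map_smul, degen_single, degenCell, map_add, map_sum,
    map_zsmul, apply_ite f, map_zero, smul_add, Finset.smul_sum, smul_ite, smul_zero,
    smul_comm t]

theorem totaroFirst_degen (T : List Letter → R) (m : ℕ) (z : CellModule R N) :
    totaroFirst T m (degen z) = (-1 : ℤ) ^ m • degen (totaroFirst T m z) := by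
  induction m generalizing T z with
  | zero =>
    rw [pow_zero, one_smul]
    exact map_degen_of_scalar (t := T []) (fun c => by simp [totaroFirst, onLabels, Cell.toA]) z
  | succ m ih =>
    simp only [totaroFirst_succ, evalFirst_degen, map_neg, ih, map_add, smul_add, pow_succ,
      mul_neg_one, neg_smul]

theorem totaroLast_degen (T : List Letter → R) (m : ℕ) (z : CellModule R N) :
    totaroLast T m (degen z) = degen (totaroLast T m z) := by
  induction m generalizing T z with
  | zero =>
    refine map_degen_of_scalar (t := T []) (fun c => ?_) z
    have h1 : c.labels.drop c.dim = [] := by simp [Cell.labels, Cell.dim]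
    have h2 : c.toB 0 = c := Cell.ext' rfl (by simp [Cell.toB, Cell.dim])
      (by simp [Cell.toB, Cell.dim])
    simp [totaroLast, onLabels, h1, h2]
  | succ m ih => simp only [totaroLast_succ, evalLast_degen, ih, map_add]

theorem totaroMap_gen (Ta Tb : List Letter → R) (k : ℕ) (c : Cell N) :
    totaroMap Ta Tb k (gen R c) = (-1 : ℤ) ^ signExp c.deg k •
      (totaroFirst Ta k (gen R c) - (-1 : ℤ) ^ ((c.dim - c.deg) * k) • totaroLast Tb k (gen R c)) := by
  simp only [totaroMap, totaroFirst, totaroLast, Finsupp.linearCombination_single, one_smul]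
  split_ifs <;> simp

theorem totaroMap_of_mem (Ta Tb : List Letter → R) (k δ n : ℕ) (z : CellModule R N)
    (hz : z ∈ AddSubgroup.closure {y | ∃ c : Cell N, y = gen R c ∧ c.deg = δ ∧ c.dim = n}) :
    totaroMap Ta Tb k z = (-1 : ℤ) ^ signExp δ k •
      (totaroFirst Ta k z - (-1 : ℤ) ^ ((n - δ) * k) • totaroLast Tb k z) := by
  induction hz using AddSubgroup.closure_induction with
  | mem x hx =>
    obtain ⟨c, rfl, rfl, rfl⟩ := hx
    exact totaroMap_gen Ta Tb k c
  | zero => simp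
  | add x y _ _ hx hy =>
    simp only [map_add, hx, hy]
    module
  | neg x _ hx =>
    simp only [map_neg, hx]
    module

theorem _root_.Cell.deg_le_dim (c : Cell N) : c.deg ≤ c.dim :=
  (List.reduceOption_length_le _).trans_eq (by simp [Cell.labels, Cell.dim])

theorem mergeAt_reduceOption (i : ℕ) (l : List (ℕ × Option Letter)) (h : mergeCoeff i l ≠ 0) :
    ((mergeAt i l).map Prod.snd).reduceOption = (l.map Prod.snd).reduceOption := by
  induction l generalizing i with
  | nil => cases i <;> simp [mergeAt]
  | cons x r ih =>
    cases i with
    | zero =>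
      obtain _ | ⟨z, r⟩ := r
      · simp [mergeAt]
      · obtain ⟨_, _ | _⟩ := x <;> obtain ⟨_, _ | _⟩ := z <;>
          simp_all [mergeAt, mergeCoeff]
    | succ i =>
      obtain ⟨_, _ | _⟩ := x <;> simp_all [mergeAt, mergeCoeff]

theorem mergeAt_length (i : ℕ) (l : List (ℕ × Option Letter)) (h : i + 1 < l.length) :
    (mergeAt i l).length + 1 = l.length := by
  induction l generalizing i with
  | nil => simp at h
  | cons x r ih =>
    cases i with
    | zero =>
      obtain _ | ⟨z, r⟩ := r
      · simp at h
      · simp [mergeAt]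
    | succ i => simp [mergeAt, ih i (by simpa using h)]

/-- `degen` is an integral combination of cells; it preserves the number of factors different
from `1` and removes one factor `1`. -/
theorem degenCell_mem (c : Cell N) : degenCell (R := R) c ∈
    AddSubgroup.closure {y | ∃ c' : Cell N, y = gen R c' ∧ c'.deg = c.deg ∧ c'.dim = c.dim - 1} := by
  refine add_mem (add_mem ?_ (sum_mem fun i hi => ?_)) (zsmul_mem ?_ _)
  · split_ifs with h
    · refine AddSubgroup.subset_closure ⟨_, rfl, ?_, ?_⟩
      · obtain ⟨p, _ | ⟨⟨s, x⟩, r⟩, q, hpos, htot⟩ := c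
        · simp [Cell.labels] at h
        · simp only [Cell.labels, List.map_cons, List.head?_cons, Option.some.injEq] at h
          simp [Cell.deg, Cell.toA, Cell.labels, h]
      · simp [Cell.dim, Cell.toA]
    · exact zero_mem _
  · by_cases h : mergeCoeff i c.blocks = 0
    · rw [h, mul_zero, zero_smul]
      exact zero_mem _
    · refine zsmul_mem ?_ _
      refine AddSubgroup.subset_closure ⟨_, rfl, ?_, ?_⟩
      · simp [Cell.deg, Cell.merge, Cell.labels, mergeAt_reduceOption _ _ h]
      · have := mergeAt_length i c.blocks (by
          have := Finset.mem_range.1 hi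
          simp only [Cell.dim] at this
          omega)
        simp only [Cell.dim, Cell.merge]
        omega
  · split_ifs with h
    · refine AddSubgroup.subset_closure ⟨_, rfl, ?_, ?_⟩
      · obtain ⟨p, r, q, hpos, htot⟩ := c
        obtain rfl | ⟨r, ⟨s, x⟩, rfl⟩ := List.eq_nil_or_concat' r
        · simp [Cell.labels] at h
        · simp [Cell.labels] at h
          simp [Cell.deg, Cell.toB, Cell.labels, Cell.dim, h, List.reduceOption_append]
      · simp [Cell.dim, Cell.toB]
    · exact zero_mem _

/-- Without factors `1` there is nothing for `degen` to remove: a summand would have more letters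
than parameters. -/
theorem degenCell_eq_zero_of_dim_le (c : Cell N) (h : c.dim ≤ c.deg) :
    degenCell (R := R) c = 0 := by
  have h' : c.dim - 1 < c.deg ∨ c.dim = 0 := by omega
  obtain h' | h' := h'
  · have := degenCell_mem (R := R) c
    rwa [show {y | ∃ c' : Cell N, y = gen R c' ∧ c'.deg = c.deg ∧ c'.dim = c.dim - 1} = ∅ from
      Set.eq_empty_of_forall_notMem fun y hy => by
        obtain ⟨c', _, h1, h2⟩ := hy
        have := c'.deg_le_dim
        omega, AddSubgroup.closure_empty, AddSubgroup.mem_bot] at this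
  · have h0 : c.blocks = [] := List.length_eq_zero_iff.1 h'
    simp [degenCell, Cell.labels, Cell.dim, h0]

/-- At `a` the sign comes from anticommuting `degen` past `m` evaluations; at `b` it comes from the
sign exponent of `totaroMap`, because `degen` removes one factor `1`. -/
theorem totaroMap_degenCell (Ta Tb : List Letter → R) (m : ℕ) (c : Cell N) :
    totaroMap Ta Tb m (degenCell c) = (-1 : ℤ) ^ m • degen (totaroMap Ta Tb m (gen R c)) := by
  -- Without factors `1` both sides vanish; this case is separate because `c.dim - 1 - c.deg` is
  -- then truncated.
  by_cases hc : c.dim ≤ c.deg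
  · have hz : degen (gen R c) = 0 := by
      rw [gen, degen_single, degenCell_eq_zero_of_dim_le c hc]
    rw [degenCell_eq_zero_of_dim_le c hc, totaroMap_gen, map_zsmul, map_sub, map_zsmul,
      ← totaroLast_degen, hz, map_zero, map_zero]
    have := totaroFirst_degen Ta m (gen R c)
    rw [hz, map_zero] at this
    rw [smul_comm, smul_zero, sub_zero, ← this, smul_zero]
  · have hs : (-1 : ℤ) ^ ((c.dim - 1 - c.deg) * m) = (-1) ^ m * (-1) ^ ((c.dim - c.deg) * m) := by
      obtain ⟨e, he⟩ := Nat.exists_eq_add_of_lt (not_le.1 hc)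
      rw [he, show c.deg + e + 1 - 1 - c.deg = e by omega,
        show c.deg + e + 1 - c.deg = e + 1 by omega, ← pow_add,
        show m + (e + 1) * m = e * m + 2 * m by ring, pow_add, pow_mul (-1 : ℤ) 2]
      simp
    rw [totaroMap_of_mem Ta Tb m c.deg (c.dim - 1) _ (degenCell_mem c), totaroMap_gen,
      ← degen_single, totaroFirst_degen, totaroLast_degen, map_zsmul, map_sub, map_zsmul, hs]
    module

/-- `α` is the sum of the map given by the letters at the two ends, which has the form of the
other maps `h^k`, and of `degen`. -/
theorem alpha_gen {xa xb : Letter → R} {Ta Tb : List Letter → R} (ha : ∀ l, Ta [l] = xa l)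
    (hb : ∀ l, Tb [l] = xb l) (c : Cell N) :
    alpha xa xb (gen R c) = totaroMap Ta Tb 1 (gen R c) + degenCell c := by
  obtain ⟨p, r, q, hpos, htot⟩ := c
  obtain rfl | ⟨r, ⟨s, x⟩, rfl⟩ := List.eq_nil_or_concat' r
  · simp [alpha, totaroMap, degenCell, Cell.labels, Cell.dim]
  · set c : Cell N := ⟨p, r ++ [(s, x)], q, hpos, htot⟩ with hc
    have hdim : c.dim = r.length + 1 := by simp [hc, Cell.dim]
    have hlast : c.labels.getLast? = some x := by simp [hc, Cell.labels]
    obtain ⟨u, t, hut⟩ : ∃ u t, c.labels = u :: t :=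
      List.exists_cons_of_ne_nil (by simp [hc, Cell.labels])
    have hdrop : c.labels.drop (c.dim - 1) = [x] := by simp [hc, Cell.labels, Cell.dim]
    have hdeg : c.deg = [x].reduceOption.length + c.labels.dropLast.reduceOption.length := by
      cases x <;> simp [hc, Cell.deg, Cell.labels, List.reduceOption_append, add_comm]
    have hd := c.deg_le_dim
    rw [hut] at hlast hdrop
    simp only [alpha, totaroMap, degenCell, Finsupp.linearCombination_single, one_smul, hut,
      List.head?_cons]
    rw [if_pos (by omega), hlast, hdrop]
    dsimp only
    have e1 : factorAt xa u • gen R (c.toA 1) = onLabels Ta (List.take 1 (u :: t)) • gen R (c.toA 1)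
        + if some u = some none then gen R (c.toA 1) else 0 := by
      cases u <;> simp [factorAt, onLabels, ha]
    have e2 : (-1 : ℤ) ^ (c.dim + [x].reduceOption.length * (u :: t).dropLast.reduceOption.length) •
          factorAt xb x • gen R (c.toB 1) =
        -((-1 : ℤ) ^ ((c.dim - c.deg) * 1) • onLabels Tb [x] • gen R (c.toB 1))
        + (-1 : ℤ) ^ c.dim • (if some x = some none then gen R (c.toB 1) else 0) := by
      rw [← hut]
      obtain _ | x := x
      · simp [factorAt, onLabels]
      · obtain ⟨e, he⟩ := Nat.exists_eq_add_of_le hd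
        rw [he, Nat.add_sub_cancel_left, hdeg]
        simp only [factorAt, onLabels, List.reduceOption_cons_of_some, List.reduceOption_nil,
          List.length_singleton, one_mul, mul_one, Option.some.injEq, reduceCtorEq, if_false,
          smul_zero, add_zero, List.mem_singleton, hb, ← neg_smul]
        congr 1
        rw [show 1 + c.labels.dropLast.reduceOption.length + e +
          c.labels.dropLast.reduceOption.length =
            e + 1 + 2 * c.labels.dropLast.reduceOption.length by ring, pow_add, pow_mul]
        simp [pow_succ]
    rw [e1, e2, signExp, Nat.sub_self, mul_zero, Nat.mul_zero, Nat.zero_div, pow_zero, one_smul]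
    abel

end Ends
/-! ### Signs and Totaro cochains -/

section Totaro

variable {R : Type u} [Ring R] [Algebra ℚ R] (A : AdamsCDGA R) {N : ℕ}

theorem sgn_of_mem {p q : ℤ} {x : R} (hx : x ∈ A.gr (p, q)) : A.sgn x = (-1 : ℚ) ^ p • x := by
  simp only [sgn, LinearMap.comp_apply, LinearEquiv.coe_coe, DirectSum.decomposeLinearEquiv_apply]
  rw [DirectSum.decompose_of_mem _ hx, ← DirectSum.lof_eq_of ℚ, DirectSum.toModule_lof]
  simp

theorem sgn_of_mem_one {q : ℤ} {x : R} (hx : x ∈ A.gr (1, q)) : A.sgn x = -x := by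
  simp [A.sgn_of_mem hx]

theorem sgn_mul {p q : ℤ} {x : R} (hx : x ∈ A.gr (p, q)) (y : R) :
    A.sgn (x * y) = (-1 : ℚ) ^ p • (x * A.sgn y) := by
  induction y using DirectSum.Decomposition.inductionOn A.gr with
  | zero => simp
  | @homogeneous i y =>
    have h : x * y ∈ A.gr ((p, q) + (i.1, i.2)) := SetLike.mul_mem_graded hx y.2
    rw [A.sgn_of_mem h, A.sgn_of_mem (p := i.1) (q := i.2) y.2, mul_smul_comm, smul_smul,
      ← zpow_add₀ (by norm_num)]
  | add y z hy hz => rw [mul_add, map_add, map_add, hy, hz, mul_add, smul_add]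

theorem mul_eq_neg_mul {q q' : ℤ} {x y : R} (hx : x ∈ A.gr (1, q)) (hy : y ∈ A.gr (1, q')) :
    x * y = -(y * x) := by
  simpa using A.comm 1 q 1 q' x y hx hy

theorem sgnC_single (c : Cell N) (r : R) :
    A.sgnC (Finsupp.single c r) = (-1 : ℚ) ^ c.deg • Finsupp.single c (A.sgn r) := by
  simp [sgnC]

theorem sgn_one : A.sgn 1 = 1 := by
  have := A.sgn_of_mem (p := 0) (q := 0) (SetLike.one_mem_graded A.gr)
  simpa using this

theorem sgnC_gen (c : Cell N) : A.sgnC (gen R c) = (-1 : ℤ) ^ c.deg • gen R c := by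
  rw [gen, sgnC_single, sgn_one]
  rcases Nat.even_or_odd c.deg with h | h <;> simp [h.neg_one_pow]

theorem sgnC_smul {p q : ℤ} {x : R} (hx : x ∈ A.gr (p, q)) (y : CellModule R N) :
    A.sgnC (x • y) = (-1 : ℚ) ^ p • x • A.sgnC y := by
  induction y using Finsupp.induction_linear with
  | zero => simp
  | add y z hy hz => rw [smul_add, map_add, map_add, hy, hz, smul_add, smul_add]
  | single c r =>
    simp only [Finsupp.smul_single, smul_eq_mul, sgnC_single, A.sgn_mul hx, mul_smul_comm]
    rw [smul_comm]

theorem diff_smul {p q : ℤ} {x : R} (hx : x ∈ A.gr (p, q)) (y : CellModule R N) :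
    A.diff (x • y) = A.d x • y + (-1 : ℚ) ^ p • x • A.diff y := by
  ext c
  simpa [diff] using A.leibniz p q x (y c) hx

theorem diff_single (c : Cell N) (r : R) :
    A.diff (Finsupp.single c r) = Finsupp.single c (A.d r) := by
  simp [diff]

/-- The square of the matrix on a homogeneous multiple of a cell: the terms that contain the
differential of the coefficient cancel. -/
theorem squareEntry_single (h : ℕ → CellModule R N →ₗ[R] CellModule R N) {k : ℕ} (hk : 1 ≤ k)
    (c : Cell N) {p q : ℤ} {r : R} (hr : r ∈ A.gr (p, q)) :
    A.squareEntry h k (Finsupp.single c r) = (-1 : ℤ) ^ c.deg • r •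
      (A.diff (h k (gen R c)) + ∑ j ∈ Finset.Ico 1 k, h (k - j) (A.sgnC (h j (gen R c)))) := by
  have hpp : (-1 : ℚ) ^ p * (-1) ^ p = 1 := by
    rw [← mul_zpow]; simp
  have hsingle : ∀ s : R, Finsupp.single c s = s • gen R c := by simp
  have hent : ∀ j, 1 ≤ j → ∀ z, A.entry h j z = h j (A.sgnC z) := by
    intro j hj z
    obtain ⟨j, rfl⟩ := Nat.exists_eq_add_of_le' hj
    rfl
  have hent0 : ∀ z, A.entry h 0 z = A.diff z := fun z => rfl
  have hq : ∀ (f : CellModule R N →ₗ[R] CellModule R N) (s : ℚ) z, f (s • z) = s • f z :=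
    fun f s z => (f.restrictScalars ℚ).map_smul s z
  have hR : ∀ (f : CellModule R N →ₗ[R] CellModule R N) (s : R) z, f (s • z) = s • f z :=
    fun f s z => f.map_smul s z
  have hd := A.sgnC_smul (A.d_mem p q r hr) (gen R c)
  have hrc := A.sgnC_smul hr (gen R c)
  rw [sgnC_gen] at hd hrc
  have hp1 : (-1 : ℚ) ^ (p + 1) = -(-1) ^ p := by
    rw [zpow_add₀ (by norm_num)]; simp
  rw [squareEntry, LinearMap.sum_apply, Finset.sum_range_succ, Finset.range_eq_Ico,
    Finset.sum_eq_sum_Ico_succ_bot (by omega)]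
  simp only [LinearMap.comp_apply, Nat.sub_self, Nat.sub_zero, hent0, hent k hk]
  have hmid : ∀ j ∈ Finset.Ico 1 k, A.entry h (k - j) (A.entry h j (Finsupp.single c r)) =
      (-1 : ℤ) ^ c.deg • r • h (k - j) (A.sgnC (h j (gen R c))) := by
    intro j hj
    have hj := Finset.mem_Ico.1 hj
    rw [hent _ (by omega), hent _ hj.1, hsingle, hrc, hq, hR, map_zsmul,
      smul_comm r, map_smul, map_zsmul, A.sgnC_smul hr, hq, map_zsmul, hq, hR,
      smul_comm ((-1 : ℚ) ^ p) ((-1 : ℤ) ^ c.deg), smul_smul ((-1 : ℚ) ^ p), hpp, one_smul]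
  rw [zero_add, Finset.sum_congr rfl hmid, A.diff_single, hsingle, hd, hsingle, hrc, hq, hq,
    hR, hR, map_zsmul, map_smul, smul_comm r, map_zsmul, A.diff_smul hr, hp1,
    ← Finset.smul_sum, ← Finset.smul_sum, smul_comm (A.d r)]
  simp only [smul_add, neg_smul, smul_comm ((-1 : ℚ) ^ p) ((-1 : ℤ) ^ c.deg), smul_smul, hpp]
  simp only [one_smul, smul_comm ((-1 : ℚ) ^ p)]
  abel

theorem squareEntry_eq_zero (h : ℕ → CellModule R N →ₗ[R] CellModule R N) {k : ℕ} (hk : 1 ≤ k)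
    (c : Cell N)
    (hc : A.diff (h k (gen R c)) + ∑ j ∈ Finset.Ico 1 k, h (k - j) (A.sgnC (h j (gen R c))) = 0)
    (r : R) : A.squareEntry h k (Finsupp.single c r) = 0 := by
  induction r using DirectSum.Decomposition.inductionOn A.gr with
  | zero => simp
  | @homogeneous i y =>
    rw [A.squareEntry_single h hk c (p := i.1) (q := i.2) y.2, hc, smul_zero, smul_zero]
  | add y z hy hz => rw [Finsupp.single_add, map_add, hy, hz, add_zero]

variable {A}

theorem IsTotaroSystem.mem_gr {x : Letter → R} {L : ℕ} {T : List Letter → R}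
    (hT : A.IsTotaroSystem x L T) (hx : ∀ l, x l ∈ A.gr (1, 1)) {w : List Letter}
    (h1 : 1 ≤ w.length) (hL : w.length ≤ L) : T w ∈ A.gr (1, (w.length : ℤ)) := by
  by_cases h2 : 2 ≤ w.length
  · exact hT.mem w h2 hL
  · obtain ⟨l, rfl⟩ := List.length_eq_one_iff.1 (show w.length = 1 by omega)
    rw [hT.letter]
    simpa using hx l

theorem length_reduceOption_of_notMem {u : List (Option Letter)} (h : none ∉ u) :
    u.reduceOption.length = u.length := by
  rw [List.reduceOption_length_eq_iff]
  intro x hx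
  cases x
  · exact absurd hx h
  · rfl

theorem IsTotaroSystem.onLabels_mem_gr {x : Letter → R} {L : ℕ} {T : List Letter → R}
    (hT : A.IsTotaroSystem x L T) (hx : ∀ l, x l ∈ A.gr (1, 1)) {u : List (Option Letter)}
    (h1 : 1 ≤ u.length) (hL : u.length ≤ L) : onLabels T u ∈ A.gr (1, (u.length : ℤ)) := by
  rw [onLabels]
  split_ifs with h
  · exact zero_mem _
  · have := length_reduceOption_of_notMem h
    rw [← this] at h1 hL ⊢
    exact hT.mem_gr hx h1 hL

theorem map_some_reduceOption {u : List (Option Letter)} (h : none ∉ u) :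
    u.reduceOption.map some = u := by
  induction u with
  | nil => rfl
  | cons x r ih =>
    obtain _ | x := x
    · simp at h
    · simp_all

/-- The Massey cochain of a word of labels; a label `1` makes every summand vanish. -/
theorem IsTotaroSystem.onLabels_massey {x : Letter → R} {L : ℕ} {T : List Letter → R}
    (hT : A.IsTotaroSystem x L T) (hx : ∀ l, x l ∈ A.gr (1, 1)) {u : List (Option Letter)}
    (hL : u.length ≤ L + 1) :
    onLabels (A.massey T) u =
      ∑ i ∈ Finset.Ico 1 u.length, onLabels T (u.take i) * onLabels T (u.drop i) := by
  by_cases h : none ∈ u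
  · rw [onLabels, if_pos h, Finset.sum_eq_zero]
    intro i _
    rw [← List.take_append_drop i u, List.mem_append] at h
    obtain h | h := h
    · rw [onLabels, if_pos h, zero_mul]
    · rw [onLabels.eq_def T (u.drop i), if_pos h, mul_zero]
  · obtain ⟨w, rfl⟩ : ∃ w : List Letter, u = w.map some := ⟨_, (map_some_reduceOption h).symm⟩
    rw [onLabels_map_some, massey, List.length_map]
    refine Finset.sum_congr rfl fun i hi => ?_
    have hi := Finset.mem_Ico.1 hi
    rw [List.length_map] at hL
    rw [← List.map_take, ← List.map_drop, onLabels_map_some, onLabels_map_some,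
      A.sgn_of_mem_one (hT.mem_gr hx _ _), neg_neg] <;>
    simp <;> omega

theorem IsTotaroSystem.d_onLabels {x : Letter → R} {L : ℕ} {T : List Letter → R}
    (hT : A.IsTotaroSystem x L T) {u : List (Option Letter)}
    (h2 : 2 ≤ u.length) (hL : u.length ≤ L) :
    A.d (onLabels T u) = onLabels (A.massey T) u := by
  rw [onLabels, onLabels]
  split_ifs with h
  · simp
  · have := length_reduceOption_of_notMem h
    exact hT.bound _ (by omega) (by omega)

end Totaro
/-! ### Composition of the maps given by Totaro cochains -/

section Composition

variable {R : Type u} [Ring R] {N : ℕ}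

theorem _root_.Cell.labels_toA (c : Cell N) (k : ℕ) : (c.toA k).labels = c.labels.drop k := by
  simp [Cell.labels, Cell.toA]

theorem _root_.Cell.labels_toB (c : Cell N) (k : ℕ) :
    (c.toB k).labels = c.labels.take (c.dim - k) := by
  simp [Cell.labels, Cell.toB]

theorem _root_.Cell.dim_toA (c : Cell N) (k : ℕ) : (c.toA k).dim = c.dim - k := by
  simp [Cell.dim, Cell.toA]

theorem _root_.Cell.dim_toB (c : Cell N) (k : ℕ) : (c.toB k).dim = c.dim - k := by
  simp [Cell.dim, Cell.toB]

theorem _root_.Cell.length_labels (c : Cell N) : c.labels.length = c.dim := by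
  simp [Cell.labels, Cell.dim]

theorem _root_.Cell.toA_toA (c : Cell N) (i j : ℕ) : (c.toA j).toA i = c.toA (j + i) := by
  refine Cell.ext' ?_ ?_ rfl
  · simp [Cell.toA, List.take_add, add_assoc]
  · simp [Cell.toA]

theorem _root_.Cell.toB_toB (c : Cell N) (i j : ℕ) : (c.toB j).toB i = c.toB (j + i) := by
  refine Cell.ext' rfl ?_ ?_
  · simp [Cell.toB, Cell.dim, List.take_take, Nat.sub_sub]
    omega
  · have h1 : c.dim - j - i = c.dim - (j + i) := by omega
    have h2 : (c.blocks.take (c.dim - j)).drop (c.dim - (j + i)) ++ c.blocks.drop (c.dim - j) =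
        c.blocks.drop (c.dim - (j + i)) := by
      rw [← List.drop_append_of_le_length, List.take_append_drop]
      simp only [List.length_take, Cell.dim]
      omega
    change (((c.blocks.take (c.dim - j)).drop ((c.toB j).dim - i)).map Prod.fst).sum +
      (((c.blocks.drop (c.dim - j)).map Prod.fst).sum + c.atB) =
      ((c.blocks.drop (c.dim - (j + i))).map Prod.fst).sum + c.atB
    rw [Cell.dim_toB, h1, ← h2, List.map_append, List.sum_append, add_assoc]

theorem _root_.Cell.toA_toB (c : Cell N) (i j : ℕ) (h : i + j ≤ c.dim) :
    (c.toB j).toA i = (c.toA i).toB j := by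
  have hd := c.dim_toA i
  refine Cell.ext' ?_ ?_ ?_
  · simp only [Cell.toA, Cell.toB, List.take_take]
    rw [min_eq_left (by omega)]
  · change (c.blocks.take (c.dim - j)).drop i = (c.blocks.drop i).take ((c.toA i).dim - j)
    rw [List.drop_take, hd]
    congr 1
    omega
  · change ((c.blocks.drop (c.dim - j)).map Prod.fst).sum + c.atB =
      (((c.blocks.drop i).drop ((c.toA i).dim - j)).map Prod.fst).sum + c.atB
    rw [List.drop_drop, hd]
    congr 5
    omega

theorem totaroFirst_gen (T : List Letter → R) {m : ℕ} {c : Cell N} (h : m ≤ c.dim) :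
    totaroFirst T m (gen R c) = onLabels T (c.labels.take m) • gen R (c.toA m) := by
  simp [totaroFirst, h]

theorem totaroLast_gen (T : List Letter → R) {m : ℕ} {c : Cell N} (h : m ≤ c.dim) :
    totaroLast T m (gen R c) = onLabels T (c.labels.drop (c.dim - m)) • gen R (c.toB m) := by
  simp [totaroLast, h]

theorem _root_.Cell.deg_toA {c : Cell N} {m : ℕ} (hm : m ≤ c.dim) (h : none ∉ c.labels.take m) :
    (c.toA m).deg + m = c.deg := by
  have h1 := length_reduceOption_of_notMem h
  have h2 : c.deg = (c.labels.take m ++ c.labels.drop m).reduceOption.length := by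
    rw [List.take_append_drop]; rfl
  rw [List.reduceOption_append, List.length_append, h1, List.length_take, c.length_labels,
    min_eq_left hm, ← c.labels_toA] at h2
  rw [h2, add_comm]
  rfl

theorem _root_.Cell.deg_toB {c : Cell N} {m : ℕ} (hm : m ≤ c.dim)
    (h : none ∉ c.labels.drop (c.dim - m)) : (c.toB m).deg + m = c.deg := by
  have h1 := length_reduceOption_of_notMem h
  have h2 : c.deg =
      (c.labels.take (c.dim - m) ++ c.labels.drop (c.dim - m)).reduceOption.length := by
    rw [List.take_append_drop]; rfl
  rw [List.reduceOption_append, List.length_append, h1, List.length_drop, c.length_labels,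
    Nat.sub_sub_self hm, ← c.labels_toB] at h2
  rw [h2]
  rfl

theorem onLabels_of_mem (T : List Letter → R) {u : List (Option Letter)} (h : none ∈ u) :
    onLabels T u = 0 := if_pos h

/-- Both ends evaluate letters, so there have to be enough of them. -/
theorem totaroFirst_eq_zero_and_totaroLast_eq_zero (Ta Tb : List Letter → R) {m : ℕ} {c : Cell N}
    (h : c.deg < m) :
    totaroFirst Ta m (gen R c) = 0 ∧ totaroLast Tb m (gen R c) = 0 := by
  by_cases hm : m ≤ c.dim
  · rw [totaroFirst_gen _ hm, totaroLast_gen _ hm, onLabels_of_mem, onLabels_of_mem]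
    · simp
    · by_contra h'
      have := Cell.deg_toB hm h'
      omega
    · by_contra h'
      have := Cell.deg_toA hm h'
      omega
  · simp [totaroFirst, totaroLast, hm]

theorem totaroMap_totaroFirst (Ta Tb T : List Letter → R) {i j : ℕ} {c : Cell N}
    (h : j ≤ c.dim) :
    totaroMap Ta Tb i (totaroFirst T j (gen R c)) = (-1 : ℤ) ^ signExp (c.deg - j) i •
      (totaroFirst Ta i (totaroFirst T j (gen R c)) -
        (-1 : ℤ) ^ ((c.dim - c.deg) * i) • totaroLast Tb i (totaroFirst T j (gen R c))) := by
  rw [totaroFirst_gen _ h]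
  by_cases hn : none ∈ c.labels.take j
  · simp [onLabels_of_mem _ hn]
  · have hd := Cell.deg_toA h hn
    have e1 : c.deg - j = (c.toA j).deg := by omega
    have e2 : c.dim - c.deg = (c.toA j).dim - (c.toA j).deg := by
      rw [c.dim_toA]; omega
    rw [map_smul, totaroMap_gen, map_smul, map_smul, e1, e2, smul_comm, smul_sub, smul_comm]

theorem totaroMap_totaroLast (Ta Tb T : List Letter → R) {i j : ℕ} {c : Cell N}
    (h : j ≤ c.dim) :
    totaroMap Ta Tb i (totaroLast T j (gen R c)) = (-1 : ℤ) ^ signExp (c.deg - j) i •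
      (totaroFirst Ta i (totaroLast T j (gen R c)) -
        (-1 : ℤ) ^ ((c.dim - c.deg) * i) • totaroLast Tb i (totaroLast T j (gen R c))) := by
  rw [totaroLast_gen _ h]
  by_cases hn : none ∈ c.labels.drop (c.dim - j)
  · simp [onLabels_of_mem _ hn]
  · have hd := Cell.deg_toB h hn
    have e1 : c.deg - j = (c.toB j).deg := by omega
    have e2 : c.dim - c.deg = (c.toB j).dim - (c.toB j).deg := by
      rw [c.dim_toB]; omega
    rw [map_smul, totaroMap_gen, map_smul, map_smul, e1, e2, smul_comm, smul_sub, smul_comm]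

theorem mul_pred_half_add (i j : ℕ) :
    (i + j) * (i + j - 1) / 2 = i * (i - 1) / 2 + j * (j - 1) / 2 + i * j := by
  simp only [← Nat.choose_two_right]
  induction j with
  | zero => simp
  | succ j ih =>
    rw [← add_assoc, Nat.choose_succ_succ' (i + j), Nat.choose_succ_succ' j, ih, Nat.choose_one_right,
      Nat.choose_one_right]
    ring

/-- The exponents `λ` add up, modulo two, to `λ + 1`. -/
theorem signExp_comp {δ i j : ℕ} (hi : 1 ≤ i) (hj : 1 ≤ j) (h : j ≤ δ) :
    (-1 : ℤ) ^ (δ + 1 + j) * ((-1) ^ signExp δ j * (-1) ^ signExp (δ - j) i) =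
      -(-1) ^ signExp δ (i + j) := by
  obtain ⟨i, rfl⟩ := Nat.exists_eq_add_of_le' hi
  obtain ⟨j, rfl⟩ := Nat.exists_eq_add_of_le' hj
  obtain ⟨m, rfl⟩ := Nat.exists_eq_add_of_le' h
  have e : m + (j + 1) + 1 + (j + 1) + (signExp (m + (j + 1)) (j + 1) +
      signExp (m + (j + 1) - (j + 1)) (i + 1)) + 2 * ((i + 1) * (j + 1)) =
      signExp (m + (j + 1)) (i + 1 + (j + 1)) + 1 + 2 * (j + 1) := by
    rw [signExp, signExp, signExp, mul_pred_half_add (i + 1) (j + 1),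
      show i + 1 + (j + 1) - 1 = i + j + 1 by omega]
    simp only [Nat.add_sub_cancel]
    ring
  rw [← pow_add, ← pow_add, ← mul_neg_one ((-1 : ℤ) ^ _), ← pow_succ]
  have h1 := congrArg (fun t => (-1 : ℤ) ^ t) e
  simpa only [pow_add _ _ (2 * _), pow_mul, neg_one_sq, one_pow, mul_one] using h1

variable [Algebra ℚ R] {A : AdamsCDGA R}

theorem sgnC_totaroFirst {x : Letter → R} {L : ℕ} {T : List Letter → R}
    (hT : A.IsTotaroSystem x L T) (hx : ∀ l, x l ∈ A.gr (1, 1)) {j : ℕ} (h1 : 1 ≤ j) (hL : j ≤ L)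
    (c : Cell N) : A.sgnC (totaroFirst T j (gen R c)) =
      (-1 : ℤ) ^ (c.deg + 1 + j) • totaroFirst T j (gen R c) := by
  by_cases h : j ≤ c.dim
  · rw [totaroFirst_gen _ h]
    by_cases hn : none ∈ c.labels.take j
    · simp [onLabels_of_mem _ hn]
    · have hd := Cell.deg_toA h hn
      have hlen : (c.labels.take j).length = j := by
        rw [List.length_take, c.length_labels, min_eq_left h]
      have hm := hT.onLabels_mem_gr hx (u := c.labels.take j) (by omega) (by omega)
      have hs : (-1 : ℤ) ^ (c.deg + 1 + j) = -(-1) ^ (c.toA j).deg := by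
        rw [← hd, show (c.toA j).deg + j + 1 + j = (c.toA j).deg + 1 + 2 * j by ring, pow_add,
          pow_mul]
        simp [pow_succ]
      rw [A.sgnC_smul hm, sgnC_gen, hs, zpow_one, neg_smul, one_smul, neg_smul, smul_comm]
  · simp [totaroFirst, h]

theorem sgnC_totaroLast {x : Letter → R} {L : ℕ} {T : List Letter → R}
    (hT : A.IsTotaroSystem x L T) (hx : ∀ l, x l ∈ A.gr (1, 1)) {j : ℕ} (h1 : 1 ≤ j) (hL : j ≤ L)
    (c : Cell N) : A.sgnC (totaroLast T j (gen R c)) =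
      (-1 : ℤ) ^ (c.deg + 1 + j) • totaroLast T j (gen R c) := by
  by_cases h : j ≤ c.dim
  · rw [totaroLast_gen _ h]
    by_cases hn : none ∈ c.labels.drop (c.dim - j)
    · simp [onLabels_of_mem _ hn]
    · have hd := Cell.deg_toB h hn
      have hlen : (c.labels.drop (c.dim - j)).length = j := by
        rw [List.length_drop, c.length_labels, Nat.sub_sub_self h]
      have hm := hT.onLabels_mem_gr hx (u := c.labels.drop (c.dim - j)) (by omega) (by omega)
      have hs : (-1 : ℤ) ^ (c.deg + 1 + j) = -(-1) ^ (c.toB j).deg := by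
        rw [← hd, show (c.toB j).deg + j + 1 + j = (c.toB j).deg + 1 + 2 * j by ring, pow_add,
          pow_mul]
        simp [pow_succ]
      rw [A.sgnC_smul hm, sgnC_gen, hs, zpow_one, neg_smul, one_smul, neg_smul, smul_comm]
  · simp [totaroLast, h]

theorem sgnC_totaroMap {xa xb : Letter → R} {L : ℕ} {Ta Tb : List Letter → R}
    (ha : A.IsTotaroSystem xa L Ta) (hb : A.IsTotaroSystem xb L Tb)
    (hxa : ∀ l, xa l ∈ A.gr (1, 1)) (hxb : ∀ l, xb l ∈ A.gr (1, 1))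
    {j : ℕ} (h1 : 1 ≤ j) (hL : j ≤ L) (c : Cell N) :
    A.sgnC (totaroMap Ta Tb j (gen R c)) =
      (-1 : ℤ) ^ (c.deg + 1 + j) • totaroMap Ta Tb j (gen R c) := by
  rw [totaroMap_gen, map_zsmul, map_sub, map_zsmul, sgnC_totaroFirst ha hxa h1 hL,
    sgnC_totaroLast hb hxb h1 hL]
  module

/-- The composite of two of the maps, up to the sign of the map `h^{i+j}`. -/
theorem totaroMap_sgnC_totaroMap {xa xb : Letter → R} {L : ℕ} {Ta Tb : List Letter → R}
    (ha : A.IsTotaroSystem xa L Ta) (hb : A.IsTotaroSystem xb L Tb)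
    (hxa : ∀ l, xa l ∈ A.gr (1, 1)) (hxb : ∀ l, xb l ∈ A.gr (1, 1))
    {i j : ℕ} (hi : 1 ≤ i) (hj : 1 ≤ j) (hL : j ≤ L) {c : Cell N} (hc : j ≤ c.dim) :
    totaroMap Ta Tb i (A.sgnC (totaroMap Ta Tb j (gen R c))) =
      -(-1 : ℤ) ^ signExp c.deg (i + j) •
        (totaroFirst Ta i (totaroFirst Ta j (gen R c))
          - ((-1 : ℤ) ^ ((c.dim - c.deg) * i) • totaroLast Tb i (totaroFirst Ta j (gen R c))
            + (-1 : ℤ) ^ ((c.dim - c.deg) * j) • totaroFirst Ta i (totaroLast Tb j (gen R c)))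
          + (-1 : ℤ) ^ ((c.dim - c.deg) * (i + j)) •
            totaroLast Tb i (totaroLast Tb j (gen R c))) := by
  -- With fewer than `j` letters both sides vanish; otherwise `c.deg - j` is not truncated.
  by_cases h : c.deg < j
  · obtain ⟨h1, h2⟩ := totaroFirst_eq_zero_and_totaroLast_eq_zero Ta Tb h
    rw [totaroMap_gen, h1, h2]
    simp
  · rw [sgnC_totaroMap ha hb hxa hxb hj hL, map_zsmul, totaroMap_gen, map_zsmul, map_sub, map_zsmul,
      totaroMap_totaroFirst _ _ _ hc, totaroMap_totaroLast _ _ _ hc,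
      ← signExp_comp hi hj (not_lt.1 h), mul_add, pow_add]
    module

theorem sum_totaroFirst_totaroFirst {x : Letter → R} {L : ℕ} {T : List Letter → R}
    (hT : A.IsTotaroSystem x L T) (hx : ∀ l, x l ∈ A.gr (1, 1)) {k : ℕ} (hk : k ≤ L + 1)
    {c : Cell N} (hc : k ≤ c.dim) :
    ∑ j ∈ Finset.Ico 1 k, totaroFirst T (k - j) (totaroFirst T j (gen R c)) =
      totaroFirst (A.massey T) k (gen R c) := by
  have hlen : (c.labels.take k).length = k := by
    rw [List.length_take, c.length_labels, min_eq_left hc]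
  rw [totaroFirst_gen _ hc, hT.onLabels_massey hx (by omega), Finset.sum_smul, hlen]
  refine Finset.sum_congr rfl fun j hj => ?_
  have hj := Finset.mem_Ico.1 hj
  rw [totaroFirst_gen _ (by omega), map_smul, totaroFirst_gen _ (by rw [c.dim_toA]; omega),
    c.toA_toA, c.labels_toA, smul_smul, Nat.add_sub_cancel' hj.2.le, List.take_take,
    min_eq_left hj.2.le, List.drop_take]

/-- The last letters are evaluated in the opposite order, whence the sign. -/
theorem sum_totaroLast_totaroLast {x : Letter → R} {L : ℕ} {T : List Letter → R}
    (hT : A.IsTotaroSystem x L T) (hx : ∀ l, x l ∈ A.gr (1, 1)) {k : ℕ} (hk : k ≤ L + 1)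
    {c : Cell N} (hc : k ≤ c.dim) :
    ∑ j ∈ Finset.Ico 1 k, totaroLast T (k - j) (totaroLast T j (gen R c)) =
      -totaroLast (A.massey T) k (gen R c) := by
  have hlen : (c.labels.drop (c.dim - k)).length = k := by
    rw [List.length_drop, c.length_labels, Nat.sub_sub_self hc]
  rw [totaroLast_gen _ hc, hT.onLabels_massey hx (by omega), Finset.sum_smul, hlen,
    ← Finset.sum_neg_distrib]
  refine Finset.sum_nbij' (fun j => k - j) (fun j => k - j) ?_ ?_ ?_ ?_ fun j hj => ?_
  any_goals
    intro j hj
    simp only [Finset.mem_Ico] at hj ⊢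
    omega
  have hj := Finset.mem_Ico.1 hj
  rw [totaroLast_gen _ (by omega), map_smul, totaroLast_gen _ (by rw [c.dim_toB]; omega),
    c.toB_toB, c.labels_toB, c.dim_toB, smul_smul, Nat.add_sub_cancel' hj.2.le, List.drop_drop,
    List.drop_take]
  rw [show c.dim - j - (k - j) = c.dim - k by omega, show c.dim - j - (c.dim - k) = k - j by omega,
    show c.dim - k + (k - j) = c.dim - j by omega, ← neg_smul]
  congr 1
  refine A.mul_eq_neg_mul (hT.onLabels_mem_gr hx ?_ ?_) (hT.onLabels_mem_gr hx ?_ ?_)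
  all_goals
    simp only [List.length_drop, List.length_take, c.length_labels]
    omega

/-- Evaluations at the two ends commute up to the sign of graded commutativity. -/
theorem totaroFirst_totaroLast {xa xb : Letter → R} {L : ℕ} {Ta Tb : List Letter → R}
    (ha : A.IsTotaroSystem xa L Ta) (hb : A.IsTotaroSystem xb L Tb)
    (hxa : ∀ l, xa l ∈ A.gr (1, 1)) (hxb : ∀ l, xb l ∈ A.gr (1, 1))
    {i j : ℕ} (hi : 1 ≤ i) (hj : 1 ≤ j) (hiL : i ≤ L) (hjL : j ≤ L) {c : Cell N}
    (hc : i + j ≤ c.dim) :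
    totaroFirst Ta i (totaroLast Tb j (gen R c)) = -totaroLast Tb j (totaroFirst Ta i (gen R c)) := by
  rw [totaroLast_gen _ (by omega), map_smul, totaroFirst_gen _ (by rw [c.dim_toB]; omega),
    totaroFirst_gen _ (by omega), map_smul, totaroLast_gen _ (by rw [c.dim_toA]; omega),
    c.toA_toB _ _ hc, c.labels_toB, c.labels_toA, c.dim_toA, smul_smul, smul_smul, List.take_take,
    List.drop_drop, min_eq_left (by omega), show i + (c.dim - i - j) = c.dim - j by omega,
    ← neg_smul]
  congr 1
  refine A.mul_eq_neg_mul (hb.onLabels_mem_gr hxb ?_ ?_) (ha.onLabels_mem_gr hxa ?_ ?_)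
  all_goals
    simp only [List.length_drop, List.length_take, c.length_labels]
    omega

/-- The composites of the maps given by Totaro cochains add up to the Massey products: the mixed
terms, with one evaluation at `a` and one at `b`, cancel in pairs. -/
theorem sum_totaroMap_sgnC_totaroMap {xa xb : Letter → R} {L : ℕ} {Ta Tb : List Letter → R}
    (ha : A.IsTotaroSystem xa L Ta) (hb : A.IsTotaroSystem xb L Tb)
    (hxa : ∀ l, xa l ∈ A.gr (1, 1)) (hxb : ∀ l, xb l ∈ A.gr (1, 1))
    {k : ℕ} (hk : k ≤ L + 1) {c : Cell N} (hc : k ≤ c.dim) :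
    ∑ j ∈ Finset.Ico 1 k, totaroMap Ta Tb (k - j) (A.sgnC (totaroMap Ta Tb j (gen R c))) =
      -totaroMap (A.massey Ta) (A.massey Tb) k (gen R c) := by
  have h1 : ∀ j ∈ Finset.Ico 1 k,
      totaroMap Ta Tb (k - j) (A.sgnC (totaroMap Ta Tb j (gen R c))) =
      -(-1 : ℤ) ^ signExp c.deg k •
        (totaroFirst Ta (k - j) (totaroFirst Ta j (gen R c))
          - ((-1 : ℤ) ^ ((c.dim - c.deg) * (k - j)) •
              totaroLast Tb (k - j) (totaroFirst Ta j (gen R c))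
            + (-1 : ℤ) ^ ((c.dim - c.deg) * j) •
              totaroFirst Ta (k - j) (totaroLast Tb j (gen R c)))
          + (-1 : ℤ) ^ ((c.dim - c.deg) * k) •
            totaroLast Tb (k - j) (totaroLast Tb j (gen R c))) := by
    intro j hj
    have hj := Finset.mem_Ico.1 hj
    have := totaroMap_sgnC_totaroMap ha hb hxa hxb (i := k - j) (by omega) hj.1 (by omega)
      (c := c) (by omega)
    rwa [Nat.sub_add_cancel hj.2.le] at this
  -- The mixed terms for `j` and `k - j` cancel.
  have h2 : ∑ j ∈ Finset.Ico 1 k, (-1 : ℤ) ^ ((c.dim - c.deg) * (k - j)) •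
        totaroLast Tb (k - j) (totaroFirst Ta j (gen R c)) =
      -∑ j ∈ Finset.Ico 1 k, (-1 : ℤ) ^ ((c.dim - c.deg) * j) •
        totaroFirst Ta (k - j) (totaroLast Tb j (gen R c)) := by
    rw [← Finset.sum_neg_distrib]
    refine Finset.sum_nbij' (fun j => k - j) (fun j => k - j) ?_ ?_ ?_ ?_ fun j hj => ?_
    any_goals
      intro j hj
      simp only [Finset.mem_Ico] at hj ⊢
      omega
    have hj := Finset.mem_Ico.1 hj
    rw [Nat.sub_sub_self hj.2.le, totaroFirst_totaroLast ha hb hxa hxb hj.1 (by omega) (by omega)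
      (by omega) (by omega), smul_neg, neg_neg]
  rw [Finset.sum_congr rfl h1, ← Finset.smul_sum, Finset.sum_add_distrib, Finset.sum_sub_distrib,
    Finset.sum_add_distrib, h2, neg_add_cancel, sub_zero, ← Finset.smul_sum,
    sum_totaroFirst_totaroFirst ha hxa hk hc, sum_totaroLast_totaroLast hb hxb hk hc, totaroMap_gen]
  module

theorem diff_totaroMap {xa xb : Letter → R} {L : ℕ} {Ta Tb : List Letter → R}
    (ha : A.IsTotaroSystem xa L Ta) (hb : A.IsTotaroSystem xb L Tb) {k : ℕ} (hk : 2 ≤ k)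
    (hkL : k ≤ L) {c : Cell N} (hc : k ≤ c.dim) :
    A.diff (totaroMap Ta Tb k (gen R c)) =
      totaroMap (A.massey Ta) (A.massey Tb) k (gen R c) := by
  have h1 : (c.labels.take k).length = k := by
    rw [List.length_take, c.length_labels, min_eq_left hc]
  have h2 : (c.labels.drop (c.dim - k)).length = k := by
    rw [List.length_drop, c.length_labels, Nat.sub_sub_self hc]
  rw [totaroMap_gen, totaroMap_gen, map_zsmul, map_sub, map_zsmul, totaroFirst_gen _ hc,
    totaroFirst_gen _ hc, totaroLast_gen _ hc, totaroLast_gen _ hc]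
  simp only [Finsupp.smul_single, smul_eq_mul, mul_one, A.diff_single]
  rw [ha.d_onLabels (by omega) (by omega), hb.d_onLabels (by omega) (by omega)]

end Composition
/-! ### The homotopies given by Totaro cochains -/

section Homotopy

variable {R : Type u} [Ring R] {N : ℕ}

theorem _root_.Cell.deg_eq_length {c : Cell N} {w : List Letter} (h : c.labels = w.map some) :
    c.deg = w.length ∧ c.dim = w.length := by
  have h1 : c.dim = w.length := by rw [← c.length_labels, h, List.length_map]
  refine ⟨?_, h1⟩
  rw [Cell.deg, length_reduceOption_of_notMem (by simp [h]), c.length_labels, h1]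

/-- On cells without factors `1` the sign of `totaroMap` is the one of `signedDiff`. -/
theorem totaroMap_eq_signedDiff (Ta Tb : List Letter → R) {k : ℕ} {c : Cell N} {w : List Letter}
    (h : c.labels = w.map some) (hk : k ≤ c.dim) :
    totaroMap Ta Tb k (gen R c) =
      signedDiff k (Ta (w.take k)) (Tb (w.drop (c.dim - k))) c := by
  obtain ⟨h1, h2⟩ := Cell.deg_eq_length h
  rw [totaroMap_gen, totaroFirst_gen _ hk, totaroLast_gen _ hk, h, ← List.map_take,
    ← List.map_drop, onLabels_map_some, onLabels_map_some, signedDiff, h1, h2]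
  simp

/-- Every summand of `degenCell` uses up a factor `1`. -/
theorem degenCell_eq_zero {c : Cell N} {w : List Letter} (h : c.labels = w.map some) :
    degenCell (R := R) c = 0 := by
  obtain ⟨h1, h2⟩ := Cell.deg_eq_length h
  exact degenCell_eq_zero_of_dim_le c (by omega)

theorem map_eq_sum_gen (f : CellModule R N →ₗ[R] CellModule R N) (x : CellModule R N) :
    f x = ∑ c ∈ x.support, x c • f (gen R c) := by
  conv_lhs => rw [← Finsupp.sum_single x, Finsupp.sum, map_sum]
  refine Finset.sum_congr rfl fun c _ => ?_
  rw [← map_smul, Finsupp.smul_single, smul_eq_mul, mul_one]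

theorem totaroMap_mem_stage (Ta Tb : List Letter → R) {k n : ℕ} {x : CellModule R N}
    (hx : x ∈ stage R N n) : totaroMap Ta Tb k x ∈ stage R N (n - k) := by
  rw [map_eq_sum_gen]
  refine Submodule.sum_mem _ fun c hc => Submodule.smul_mem _ _ ?_
  have hdim : c.dim = n := (Finsupp.mem_supported R x).1 hx hc
  rw [totaroMap_gen]
  by_cases hk : k ≤ c.dim
  · rw [totaroFirst_gen _ hk, totaroLast_gen _ hk]
    refine zsmul_mem (sub_mem (Submodule.smul_mem _ _ ?_)
      (zsmul_mem (Submodule.smul_mem _ _ ?_) _)) _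
    · exact Finsupp.single_mem_supported R _ (hdim ▸ c.dim_toA k)
    · exact Finsupp.single_mem_supported R _ (hdim ▸ c.dim_toB k)
  · simp [totaroFirst, totaroLast, hk]

theorem totaroFamily_apply {xa xb : Letter → R} {Ta Tb : List Letter → R} (ha : ∀ l, Ta [l] = xa l)
    (hb : ∀ l, Tb [l] = xb l) (k : ℕ) (z : CellModule R N) :
    totaroFamily xa xb Ta Tb k z = totaroMap Ta Tb k z + if k = 1 then degen z else 0 := by
  rw [totaroFamily]
  split_ifs with h
  · subst h
    suffices h : alpha xa xb = totaroMap Ta Tb 1 + degen (R := R) (N := N) from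
      LinearMap.congr_fun h z
    exact eq_of_eq_on_single fun c => by simpa using alpha_gen ha hb c
  · rw [add_zero]

variable [Algebra ℚ R] (A : AdamsCDGA R)

theorem sgnC_degenCell (c : Cell N) :
    A.sgnC (degenCell (R := R) c) = (-1 : ℤ) ^ c.deg • degenCell c := by
  suffices h : ∀ z ∈ AddSubgroup.closure
      {y | ∃ c' : Cell N, y = gen R c' ∧ c'.deg = c.deg ∧ c'.dim = c.dim - 1},
      A.sgnC z = (-1 : ℤ) ^ c.deg • z from h _ (degenCell_mem c)
  intro z hz
  induction hz using AddSubgroup.closure_induction with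
  | mem y hy =>
    obtain ⟨c', rfl, h, _⟩ := hy
    rw [sgnC_gen, h]
  | zero => simp
  | add y z _ _ hy hz => rw [map_add, hy, hz, smul_add]
  | neg y _ hy => rw [map_neg, hy, smul_neg]

variable {A}

theorem HasBidegree.add {p q : ℤ} {x y : CellModule R N} (hx : A.HasBidegree x p q)
    (hy : A.HasBidegree y p q) : A.HasBidegree (x + y) p q :=
  fun c => add_mem (hx c) (hy c)

theorem HasBidegree.zsmul {p q : ℤ} {x : CellModule R N} (hx : A.HasBidegree x p q) (e : ℤ) :
    A.HasBidegree (e • x) p q :=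
  fun c => zsmul_mem (hx c) e

theorem hasBidegree_zero (p q : ℤ) : A.HasBidegree (0 : CellModule R N) p q :=
  fun _ => zero_mem _

theorem hasBidegree_single {p q : ℤ} {c : Cell N} {r : R} (hr : r ∈ A.gr (p - c.deg, q - c.deg)) :
    A.HasBidegree (Finsupp.single c r) p q := by
  intro c'
  by_cases h : c = c'
  · subst h
    simpa using hr
  · rw [Finsupp.single_eq_of_ne' h]
    exact zero_mem _

theorem hasBidegree_totaroFirst {x : Letter → R} {L : ℕ} {T : List Letter → R}
    (hT : A.IsTotaroSystem x L T) (hx : ∀ l, x l ∈ A.gr (1, 1)) {k : ℕ} (hk : 1 ≤ k) (hL : k ≤ L)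
    {p q : ℤ} {c : Cell N} {r : R} (hr : r ∈ A.gr (p - c.deg, q - c.deg)) :
    A.HasBidegree (r • totaroFirst T k (gen R c)) (p + 1 - k) q := by
  by_cases hc : k ≤ c.dim
  · rw [totaroFirst_gen _ hc]
    by_cases hn : none ∈ c.labels.take k
    · rw [onLabels_of_mem _ hn, zero_smul, smul_zero]
      exact hasBidegree_zero _ _
    · have hd := Cell.deg_toA hc hn
      have hlen : (c.labels.take k).length = k := by
        rw [List.length_take, c.length_labels, min_eq_left hc]
      have hm := hT.onLabels_mem_gr hx (u := c.labels.take k) (by omega) (by omega)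
      rw [smul_smul, Finsupp.smul_single, smul_eq_mul, mul_one]
      apply hasBidegree_single
      have := SetLike.mul_mem_graded hr hm
      rw [hlen] at this
      convert this using 2
      simp only [Prod.mk_add_mk, ← hd, Prod.mk.injEq, Nat.cast_add]
      constructor <;> ring
  · simp only [totaroFirst, Finsupp.linearCombination_single, if_neg hc, smul_zero]
    exact hasBidegree_zero _ _

theorem hasBidegree_totaroLast {x : Letter → R} {L : ℕ} {T : List Letter → R}
    (hT : A.IsTotaroSystem x L T) (hx : ∀ l, x l ∈ A.gr (1, 1)) {k : ℕ} (hk : 1 ≤ k) (hL : k ≤ L)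
    {p q : ℤ} {c : Cell N} {r : R} (hr : r ∈ A.gr (p - c.deg, q - c.deg)) :
    A.HasBidegree (r • totaroLast T k (gen R c)) (p + 1 - k) q := by
  by_cases hc : k ≤ c.dim
  · rw [totaroLast_gen _ hc]
    by_cases hn : none ∈ c.labels.drop (c.dim - k)
    · rw [onLabels_of_mem _ hn, zero_smul, smul_zero]
      exact hasBidegree_zero _ _
    · have hd := Cell.deg_toB hc hn
      have hlen : (c.labels.drop (c.dim - k)).length = k := by
        rw [List.length_drop, c.length_labels, Nat.sub_sub_self hc]
      have hm := hT.onLabels_mem_gr hx (u := c.labels.drop (c.dim - k)) (by omega) (by omega)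
      rw [smul_smul, Finsupp.smul_single, smul_eq_mul, mul_one]
      apply hasBidegree_single
      have := SetLike.mul_mem_graded hr hm
      rw [hlen] at this
      convert this using 2
      simp only [Prod.mk_add_mk, ← hd, Prod.mk.injEq, Nat.cast_add]
      constructor <;> ring
  · simp only [totaroLast, Finsupp.linearCombination_single, if_neg hc, smul_zero]
    exact hasBidegree_zero _ _

theorem hasBidegree_totaroMap {xa xb : Letter → R} {L : ℕ} {Ta Tb : List Letter → R}
    (ha : A.IsTotaroSystem xa L Ta) (hb : A.IsTotaroSystem xb L Tb)
    (hxa : ∀ l, xa l ∈ A.gr (1, 1)) (hxb : ∀ l, xb l ∈ A.gr (1, 1))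
    {k : ℕ} (hk : 1 ≤ k) (hL : k ≤ L) {p q : ℤ} {x : CellModule R N} (hx : A.HasBidegree x p q) :
    A.HasBidegree (totaroMap Ta Tb k x) (p + 1 - k) q := by
  rw [map_eq_sum_gen]
  refine Finset.sum_induction _ (fun y => A.HasBidegree y (p + 1 - k) q)
    (fun _ _ => HasBidegree.add) (hasBidegree_zero _ _) fun c _ => ?_
  have h1 := hasBidegree_totaroFirst ha hxa hk hL (hx c)
  have h2 := hasBidegree_totaroLast hb hxb hk hL (hx c)
  have h := (h1.add (h2.zsmul (-(-1) ^ ((c.dim - c.deg) * k)))).zsmul ((-1) ^ signExp c.deg k)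
  rw [totaroMap_gen, smul_comm (x c), smul_sub, smul_comm (x c), sub_eq_add_neg, ← neg_smul]
  exact h

/-- The terms with `degen` cancel because `degen` has square zero and commutes up to sign with the
maps given by Totaro cochains; the others give the Massey products, which are bounded by
`totaroMap`. -/
theorem isHomotopy_totaroFamily {xa xb : Letter → R} {Ta Tb : List Letter → R} {n k : ℕ}
    (ha : A.IsTotaroSystem xa k Ta) (hb : A.IsTotaroSystem xb k Tb)
    (hxa : ∀ l, xa l ∈ A.gr (1, 1)) (hxb : ∀ l, xb l ∈ A.gr (1, 1)) (hk : 2 ≤ k) (hkn : k ≤ n) :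
    A.IsHomotopy (N := N) (totaroFamily xa xb Ta Tb) n k := by
  have hfam := totaroFamily_apply (N := N) ha.letter hb.letter
  have hfk : ∀ z : CellModule R N, totaroFamily xa xb Ta Tb k z = totaroMap Ta Tb k z := by
    intro z
    rw [hfam, if_neg (by omega), add_zero]
  refine ⟨fun x hx => ?_, fun x _ p q hx => ?_, fun x hx => ?_⟩
  · rw [hfk]
    exact totaroMap_mem_stage Ta Tb hx
  · rw [hfk]
    exact hasBidegree_totaroMap ha hb hxa hxb (by omega) le_rfl hx
  · rw [← Finsupp.sum_single x, Finsupp.sum, map_sum]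
    refine Finset.sum_eq_zero fun c hc => A.squareEntry_eq_zero _ (by omega) c ?_ _
    have hdim : c.dim = n := (Finsupp.mem_supported R x).1 hx hc
    -- Only `j = 1` and `j = k - 1` involve `degen`; for `k = 2`, where both are the same `j`, there is
    -- also the square of `degen`, which is zero.
    have hterm : ∀ j ∈ Finset.Ico 1 k,
        totaroFamily xa xb Ta Tb (k - j)
          (A.sgnC (totaroFamily xa xb Ta Tb j (gen R c))) =
        totaroMap Ta Tb (k - j) (A.sgnC (totaroMap Ta Tb j (gen R c)))
          + ((if j = 1 then (-1 : ℤ) ^ c.deg • totaroMap Ta Tb (k - 1) (degenCell c) else 0)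
          + (if j = k - 1 then
              (-1 : ℤ) ^ (c.deg + k) • degen (totaroMap Ta Tb (k - 1) (gen R c)) else 0)) := by
      intro j hj
      have hj := Finset.mem_Ico.1 hj
      have hs := sgnC_totaroMap ha hb hxa hxb hj.1 hj.2.le c
      have e0 : A.sgnC (if j = 1 then degen (gen R c) else 0) =
          if j = 1 then (-1 : ℤ) ^ c.deg • degenCell c else 0 := by
        split_ifs
        · rw [gen, degen_single, sgnC_degenCell]
        · exact map_zero _
      have e1 : degen (if j = 1 then (-1 : ℤ) ^ c.deg • degenCell (R := R) c else 0) = 0 := by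
        split_ifs
        · rw [map_zsmul, degen_degenCell, smul_zero]
        · exact map_zero _
      have e2 : totaroMap Ta Tb (k - j) (if j = 1 then (-1 : ℤ) ^ c.deg • degenCell (R := R) c else 0)
          = if j = 1 then (-1 : ℤ) ^ c.deg • totaroMap Ta Tb (k - 1) (degenCell c) else 0 := by
        split_ifs with h1
        · rw [map_zsmul, h1]
        · exact map_zero _
      have e3 : (if k - j = 1 then degen (A.sgnC (totaroMap Ta Tb j (gen R c))) else 0) =
          if j = k - 1 then (-1 : ℤ) ^ (c.deg + k) • degen (totaroMap Ta Tb (k - 1) (gen R c))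
          else 0 := by
        by_cases hj1 : j = k - 1
        · rw [if_pos (by omega), if_pos hj1, hs, map_zsmul, hj1,
            show c.deg + 1 + (k - 1) = c.deg + k by omega]
        · rw [if_neg (by omega), if_neg hj1]
      rw [hfam, hfam, map_add A.sgnC, map_add (totaroMap Ta Tb (k - j)), map_add degen, e0, e1, e2,
        add_zero, e3, add_assoc]
    rw [Finset.sum_congr rfl hterm, Finset.sum_add_distrib, Finset.sum_add_distrib, hfk,
      Finset.sum_ite_eq' , Finset.sum_ite_eq', if_pos (Finset.mem_Ico.2 (by omega)),
      if_pos (Finset.mem_Ico.2 (by omega)),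
      sum_totaroMap_sgnC_totaroMap ha hb hxa hxb (by omega) (by omega),
      diff_totaroMap ha hb hk le_rfl (by omega), totaroMap_degenCell]
    obtain ⟨m, rfl⟩ := Nat.exists_eq_add_of_le' (show 1 ≤ k by omega)
    rw [Nat.add_sub_cancel, pow_add, pow_succ]
    module

/-- Solve the homotopy equation for the coboundary of `h^k`. -/
theorem diff_of_isHomotopy {xa xb : Letter → R} {Ta Tb : List Letter → R} {n k : ℕ}
    (ha : A.IsTotaroSystem xa (k - 1) Ta) (hb : A.IsTotaroSystem xb (k - 1) Tb)
    (hxa : ∀ l, xa l ∈ A.gr (1, 1)) (hxb : ∀ l, xb l ∈ A.gr (1, 1)) (hk : 2 ≤ k) (hkn : k ≤ n)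
    {h : ℕ → CellModule R N →ₗ[R] CellModule R N} (h1 : h 1 = alpha xa xb)
    (hh : ∀ j i : ℕ, 2 ≤ j → j < k → j ≤ i → i ≤ n → ∀ (c : Cell N) (w : List Letter),
      c.dim = i → c.labels = w.map some →
        h j (gen R c) = signedDiff j (Ta (w.take j)) (Tb (w.drop (i - j))) c)
    (hhom : A.IsHomotopy h n k) {c : Cell N} {w : List Letter} (hc : c.dim = n)
    (hw : c.labels = w.map some) :
    A.diff (h k (gen R c)) = totaroMap (A.massey Ta) (A.massey Tb) k (gen R c) := by
  have key : ∀ j, 1 ≤ j → j < k → ∀ (c : Cell N) (w : List Letter), j ≤ c.dim → c.dim ≤ n →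
      c.labels = w.map some → h j (gen R c) = totaroMap Ta Tb j (gen R c) := by
    intro j hj hjk c w hjc hcn hw
    obtain rfl | hj := hj.eq_or_lt
    · rw [h1, alpha_gen ha.letter hb.letter, degenCell_eq_zero hw, add_zero]
    · rw [hh j _ hj hjk hjc hcn c w rfl hw, totaroMap_eq_signedDiff _ _ hw hjc]
  have hsq := hhom.square (gen R c) (Finsupp.single_mem_supported R _ hc)
  rw [gen, A.squareEntry_single h (by omega) c (SetLike.one_mem_graded A.gr), one_smul] at hsq
  have hterm : ∀ j ∈ Finset.Ico 1 k, h (k - j) (A.sgnC (h j (gen R c))) =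
      totaroMap Ta Tb (k - j) (A.sgnC (totaroMap Ta Tb j (gen R c))) := by
    intro j hj
    have hj := Finset.mem_Ico.1 hj
    have hjc : j ≤ c.dim := by omega
    have hA : (c.toA j).labels = (w.drop j).map some := by
      rw [c.labels_toA, hw, List.map_drop]
    have hB : (c.toB j).labels = (w.take (c.dim - j)).map some := by
      rw [c.labels_toB, hw, List.map_take]
    have e1 := key (k - j) (by omega) (by omega) (c.toA j) _ (by rw [c.dim_toA]; omega)
      (by rw [c.dim_toA]; omega) hA
    have e2 := key (k - j) (by omega) (by omega) (c.toB j) _ (by rw [c.dim_toB]; omega)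
      (by rw [c.dim_toB]; omega) hB
    rw [key j hj.1 hj.2 c w hjc (by omega) hw,
      sgnC_totaroMap ha hb hxa hxb hj.1 (by omega), totaroMap_gen, totaroFirst_gen _ hjc,
      totaroLast_gen _ hjc]
    simp only [map_zsmul, map_sub, map_smul, e1, e2]
  rw [Finset.sum_congr rfl hterm,
    sum_totaroMap_sgnC_totaroMap ha hb hxa hxb (by omega) (by omega)] at hsq
  have hunit : ((-1 : ℤ) ^ c.deg) * (-1) ^ c.deg = 1 := by
    rw [← mul_pow]; simp
  have h0 := congrArg (fun z => (-1 : ℤ) ^ c.deg • z) hsq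
  simp only [smul_smul, hunit, one_smul, smul_zero] at h0
  exact sub_eq_zero.1 (by rw [sub_eq_add_neg]; exact h0)

end Homotopy
end AdamsCDGA

theorem mainTheorem2 {R : Type u} [Ring R] [Algebra ℚ R] (A : AdamsCDGA R)
    {F : Type v} [Field F] (sym : Fˣ → R)
    (sym_mem : ∀ f, sym f ∈ A.gr (1, 1)) (sym_cocycle : ∀ f, A.d (sym f) = 0)
    (a b : PuncturedLine F) (N n k : ℕ) (hk : 2 ≤ k) (hkn : k ≤ n)
    (Ta Tb : List Letter → R) :
    -- the coboundary of the homotopy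
    (A.IsTotaroSystem (sym ∘ a.eval) (k - 1) Ta →
      A.IsTotaroSystem (sym ∘ b.eval) (k - 1) Tb →
      ∀ h : ℕ → AdamsCDGA.CellModule R N →ₗ[R] AdamsCDGA.CellModule R N,
        h 1 = AdamsCDGA.alpha (sym ∘ a.eval) (sym ∘ b.eval) →
        (∀ j i : ℕ, 2 ≤ j → j < k → j ≤ i → i ≤ n → ∀ (c : Cell N) (w : List Letter),
          c.dim = i → c.labels = w.map some →
          h j (AdamsCDGA.gen R c) =
            AdamsCDGA.signedDiff j (Ta (w.take j)) (Tb (w.drop (i - j))) c) →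
        A.IsHomotopy h n k →
        ∀ (c : Cell N) (w : List Letter), c.dim = n → c.labels = w.map some →
          A.diff (h k (AdamsCDGA.gen R c)) =
            AdamsCDGA.signedDiff k (A.massey Ta (w.take k)) (A.massey Tb (w.drop (n - k))) c) ∧
    -- the definition of the homotopy by Totaro cochains
    (A.IsTotaroSystem (sym ∘ a.eval) k Ta →
      A.IsTotaroSystem (sym ∘ b.eval) k Tb →
      A.IsHomotopy (N := N)
        (AdamsCDGA.totaroFamily (sym ∘ a.eval) (sym ∘ b.eval) Ta Tb) n k ∧
      ∀ (c : Cell N) (w : List Letter), c.dim = n → c.labels = w.map some →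
        AdamsCDGA.totaroFamily (sym ∘ a.eval) (sym ∘ b.eval) Ta Tb k (AdamsCDGA.gen R c) =
          AdamsCDGA.signedDiff k (Ta (w.take k)) (Tb (w.drop (n - k))) c) := by
  have hxa : ∀ l, (sym ∘ a.eval) l ∈ A.gr (1, 1) := fun l => sym_mem _
  have hxb : ∀ l, (sym ∘ b.eval) l ∈ A.gr (1, 1) := fun l => sym_mem _
  refine ⟨fun ha hb h h1 hh hhom c w hc hw => ?_, fun ha hb =>
    ⟨AdamsCDGA.isHomotopy_totaroFamily ha hb hxa hxb hk hkn, fun c w hc hw => ?_⟩⟩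
  · rw [AdamsCDGA.diff_of_isHomotopy ha hb hxa hxb hk hkn h1 hh hhom hc hw,
      AdamsCDGA.totaroMap_eq_signedDiff _ _ hw (by omega), hc]
  · rw [AdamsCDGA.totaroFamily, if_neg (by omega),
      AdamsCDGA.totaroMap_eq_signedDiff _ _ hw (by omega), hc]
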